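/- **Right kernel of the element/edge incidence matrix.** Let a triangular mesh in $\mathbb R^2$ be given: a finite set $\mathcal V$ of vertexes with positions in $\mathbb R^2$, and a finite set $\mathcal T$ of elements, which are nondegenerate triangles with vertexes in $\mathcal V$ and with pairwise disjoint interiors, every vertex belonging to some element. (Distinct vertexes may have the same position, so that cracks are allowed.) Let $\mathcal E$ be the set of edges (sides of elements), $\mathring{\mathcal E}$ the set of internal edges, i.e. those that are a side of two elements, $\mathcal E_\partial=\mathcal E\setminus\mathring{\mathcal E}$, $\mathcal V_\partial$ the set of ends of edges of $\mathcal E_\partial$, and $\mathring{\mathcal V}=\mathcal V\setminus\mathcal V_\partial$ the set of internal vertexes. Let $\Omega$ be the union of the open triangles, of the internal edges without their ends, and of the internal vertexes, and assume that $\Omega$ is connected. A hole is a bounded connected component of $\mathbb R^2\setminus\Omega$; let $h$ be the number of holes. Give every internal edge an initial and a final vertex, and orient all elements counter-clockwise. Let $\Delta=(\delta_T^\Gamma)\in\mathbb R^{\mathcal T\times\mathring{\mathcal E}}$, where $\delta_T^\Gamma=0$ if $\Gamma$ is not a side of $T$, $\delta_T^\Gamma=1$ if it is and the orientations of $\Gamma$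 and $T$ match, and $\delta_T^\Gamma=-1$ otherwise. For a vertex $v$ let $r_v\in\mathbb R^{\mathring{\mathcal E}}$ be the vector whose entry is $1$ at the internal edges that start at $v$, $-1$ at those that end at $v$, and $0$ elsewhere. Then: 1. $\operatorname{rank}\Delta=|\mathcal T|-1$. 2. The number $h$ is finite, and $\dim\ker\Delta=|\mathring{\mathcal V}|+h$. 3. The vectors $N_v=r_v$, $v\in\mathring{\mathcal V}$ (star-patches), and $N_C=\sum_{v \text{ lying on } C} r_v$, $C$ a hole (loops around the holes), form together a basis $N=[N_V,N_h]$ of $\ker\Delta$. Each of them is a closed circuit: its entries are in $\{-1,0,1\}$, and for every element $T$ the products $\delta_T^\Gamma N^\Gamma$ either all vanish or are $1$ for one edge, $-1$ for another edge, and $0$ for all the others. 4. If $|\mathcal E_\partial|=|\mathcal V_\partial|$, then Euler's identity $|\mathcal T|-|\mathcal E|+|\mathcal V|=1-h$ holds. -/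

import Mathlib

noncomputable section

/-- A triangular mesh in the plane, with vertexes indexed by a finite type `V`.

The elements are nondegenerate triangles with pairwise disjoint interiors, and every vertex belongs
to some element.  Two elements are glued along an edge exactly when they have its two vertexes (as
elements of `V`) in common.  `pos` need not be injective, so that the two lips of a crack are
described in the usual way, by duplicated vertexes having the same position. -/
structure PlanarMesh (V : Type*) [Fintype V] [DecidableEq V] where
  /-- position of a vertex -/
  pos : V → EuclideanSpace ℝ (Fin 2)
  /-- the set of elements, given by their vertexes -/
  elements : Finset (Finset V)
  card_eq_three : ∀ t ∈ elements, t.card = 3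
  nondegenerate : ∀ t ∈ elements, AffineIndependent ℝ (fun v : t => pos v)
  /-- distinct open triangles are disjoint -/
  disjoint_interiors : ∀ t ∈ elements, ∀ t' ∈ elements, t ≠ t' →
    Disjoint {x | ∃ w : V → ℝ, (∀ v ∈ t, 0 < w v) ∧ ∑ v ∈ t, w v = 1 ∧ x = ∑ v ∈ t, w v • pos v}
      {x | ∃ w : V → ℝ, (∀ v ∈ t', 0 < w v) ∧ ∑ v ∈ t', w v = 1 ∧ x = ∑ v ∈ t', w v • pos v}
  exists_element : ∀ v : V, ∃ t ∈ elements, v ∈ t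

namespace PlanarMesh

variable {V : Type*} [Fintype V] [DecidableEq V]

/-- The set of edges: the sides of the elements. -/
def edges (M : PlanarMesh V) : Finset (Finset V) :=
  M.elements.biUnion (fun t => t.powersetCard 2)

/-- Internal edges: the edges separating two elements. -/
def internalEdges (M : PlanarMesh V) : Finset (Finset V) :=
  M.edges.filter (fun e => (M.elements.filter (fun t => e ⊆ t)).card = 2)

/-- Border edges: the other ones. -/
def boundaryEdges (M : PlanarMesh V) : Finset (Finset V) :=
  M.edges \ M.internalEdges

/-- Boundary vertexes: the ends of the border edges. -/
def boundaryVertices (M : PlanarMesh V) : Finset V :=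
  Finset.univ.filter (fun v => ∃ e ∈ M.boundaryEdges, v ∈ e)

/-- Internal vertexes: the other ones. -/
def internalVertices (M : PlanarMesh V) : Finset V :=
  Finset.univ \ M.boundaryVertices

/-- The open cell spanned by a set of vertexes: open triangle, edge without its ends, or point. -/
def openCell (M : PlanarMesh V) (s : Finset V) : Set (EuclideanSpace ℝ (Fin 2)) :=
  {x | ∃ w : V → ℝ, (∀ v ∈ s, 0 < w v) ∧ ∑ v ∈ s, w v = 1 ∧ x = ∑ v ∈ s, w v • M.pos v}

/-- The domain `Ω` occupied by the structure: the open triangles, glued along the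
internal edges and at the internal vertexes. It is an open set. For a conforming mesh without
duplicated vertexes it is the interior of the union of the closed triangles. -/
def domain (M : PlanarMesh V) : Set (EuclideanSpace ℝ (Fin 2)) :=
  (⋃ t ∈ M.elements, M.openCell t) ∪ (⋃ e ∈ M.internalEdges, M.openCell e) ∪
    (⋃ v ∈ M.internalVertices, {M.pos v})

/-- The holes: the bounded connected components of the complement of the domain. -/
def holes (M : PlanarMesh V) : Set (Set (EuclideanSpace ℝ (Fin 2))) :=
  {C | (∃ x ∈ M.domainᶜ, C = connectedComponentIn M.domainᶜ x) ∧ Bornology.IsBounded C}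

/-- The number `h` of holes. -/
def numHoles (M : PlanarMesh V) : ℕ := M.holes.ncard

/-- A choice of an initial vertex `tail e` and of a final vertex `head e` for every internal
edge. -/
structure EdgeOrientation (M : PlanarMesh V) where
  tail : Finset V → V
  head : Finset V → V
  ends : ∀ e ∈ M.internalEdges, e = {tail e, head e}

/-- The planar cross product. -/
def cross (a b : EuclideanSpace ℝ (Fin 2)) : ℝ := a 0 * b 1 - a 1 * b 0

/-- The coefficient `δ` of an element `t` and an internal edge `e`, all elements being oriented
counter-clockwise. It is `0` if `e` is not a side of `t`. If it is, `t \ e` consists of one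
vertex `v`, and the coefficient is `1` when `tail e, head e, v` are in counter-clockwise
order (the orientations of `e` and `t` match) and `-1` otherwise. -/
def delta (M : PlanarMesh V) (o : M.EdgeOrientation) (t e : Finset V) : ℝ :=
  if e ⊆ t then
    ∑ v ∈ t \ e, Real.sign
      (cross (M.pos (o.head e) - M.pos (o.tail e)) (M.pos v - M.pos (o.tail e)))
  else 0

/-- The incidence matrix `Δ` between elements (rows) and internal edges (columns). -/
def incidence (M : PlanarMesh V) (o : M.EdgeOrientation) :
    Matrix M.elements M.internalEdges ℝ :=
  Matrix.of fun t e => M.delta o t e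

/-- The internal edges radiating from the vertex `v`, all of them directed away from `v`: the
coefficient of an internal edge is `1` if it starts at `v`, `-1` if it ends at `v`, and `0`
if `v` is not one of its ends. For an internal vertex `v` this is the vector of its star-patch. -/
def rays (M : PlanarMesh V) (o : M.EdgeOrientation) (v : V) : M.internalEdges → ℝ :=
  fun e => (if o.tail e = v then 1 else 0) - (if o.head e = v then 1 else 0)

open Classical in
/-- The loop around a hole `C`: the sum of the internal edges radiating from the vertexes of the
mesh that lie on `C`, all of them directed away from these vertexes. -/
def holeLoop (M : PlanarMesh V) (o : M.EdgeOrientation) (C : Set (EuclideanSpace ℝ (Fin 2))) :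
    M.internalEdges → ℝ :=
  ∑ v : V, if M.pos v ∈ C then M.rays o v else 0

/-- Closed circuits across the mesh: every internal edge is crossed at most once (the sign being the
direction of the crossing), and every element which is met is met exactly twice, with opposite
signs (it is entered through one of its edges and left through another one). -/
def IsClosedCircuit (M : PlanarMesh V) (o : M.EdgeOrientation) (w : M.internalEdges → ℝ) : Prop :=
  (∀ e, w e = -1 ∨ w e = 0 ∨ w e = 1) ∧
  ∀ t : M.elements,
    (∀ e, M.incidence o t e * w e = 0) ∨
    ∃ e₁ e₂, M.incidence o t e₁ * w e₁ = 1 ∧ M.incidence o t e₂ * w e₂ = -1 ∧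
      ∀ e, e ≠ e₁ → e ≠ e₂ → M.incidence o t e * w e = 0

end PlanarMesh

end

noncomputable section

namespace PlanarMesh

open Filter Topology Set

section

variable {V : Type*} [Fintype V] [DecidableEq V] (M : PlanarMesh V)

/-! ### Barycentric coordinates -/

lemma exists_bary {t : Finset V} (ht : t ∈ M.elements) :
    ∃ l : V → (EuclideanSpace ℝ (Fin 2) →ᵃ[ℝ] ℝ),
      (∀ u ∈ t, ∀ v ∈ t, l v (M.pos u) = if v = u then 1 else 0) ∧
      (∀ y, ∑ v ∈ t, l v y = 1) ∧ ∀ y, ∑ v ∈ t, l v y • M.pos v = y := by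
  have hs : affineSpan ℝ (Set.range (fun v : t => M.pos v)) = ⊤ := by
    rw [(M.nondegenerate t ht).affineSpan_eq_top_iff_card_eq_finrank_add_one]
    simp [M.card_eq_three t ht]
  let b : AffineBasis t ℝ (EuclideanSpace ℝ (Fin 2)) := ⟨_, M.nondegenerate t ht, hs⟩
  have hb : ∀ v : t, b v = M.pos v := fun v => rfl
  refine ⟨fun v => if h : v ∈ t then b.coord ⟨v, h⟩ else 0, fun u hu v hv => ?_, fun y => ?_,
    fun y => ?_⟩
  · have := b.coord_apply ⟨v, hv⟩ ⟨u, hu⟩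
    rw [hb] at this
    simpa [hv] using this
  · rw [← Finset.sum_coe_sort, ← b.sum_coord_apply_eq_one y]
    exact Finset.sum_congr rfl fun v _ => by simp
  · rw [← Finset.sum_coe_sort]
    conv_rhs => rw [← b.linear_combination_coord_eq_self y]
    exact Finset.sum_congr rfl fun v _ => by simp [hb]

open Classical in
/-- The barycentric coordinates in an element. -/
def bary (t : Finset V) : V → (EuclideanSpace ℝ (Fin 2) →ᵃ[ℝ] ℝ) :=
  if ht : t ∈ M.elements then (M.exists_bary ht).choose else 0

variable {M} {t t' s s' r : Finset V} {x y : EuclideanSpace ℝ (Fin 2)} {u v : V}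

lemma bary_spec (ht : t ∈ M.elements) :
      (∀ u ∈ t, ∀ v ∈ t, M.bary t v (M.pos u) = if v = u then 1 else 0) ∧
      (∀ y, ∑ v ∈ t, M.bary t v y = 1) ∧ ∀ y, ∑ v ∈ t, M.bary t v y • M.pos v = y := by
  rw [bary, dif_pos ht]
  exact (M.exists_bary ht).choose_spec

lemma bary_pos (ht : t ∈ M.elements) (hu : u ∈ t) (hv : v ∈ t) :
    M.bary t v (M.pos u) = if v = u then 1 else 0 := (bary_spec ht).1 u hu v hv

lemma bary_self (ht : t ∈ M.elements) (hu : u ∈ t) : M.bary t u (M.pos u) = 1 := by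
  simp [bary_pos ht hu hu]

lemma bary_ne (ht : t ∈ M.elements) (hu : u ∈ t) (hv : v ∈ t) (h : v ≠ u) :
    M.bary t v (M.pos u) = 0 := by
  simp [bary_pos ht hu hv, h]

lemma sum_bary (ht : t ∈ M.elements) (y) : ∑ v ∈ t, M.bary t v y = 1 := (bary_spec ht).2.1 y

lemma sum_bary_smul (ht : t ∈ M.elements) (y) : ∑ v ∈ t, M.bary t v y • M.pos v = y :=
  (bary_spec ht).2.2 y

@[fun_prop]
lemma continuous_bary (t : Finset V) (v : V) : Continuous (M.bary t v) :=
  AffineMap.continuous_of_finiteDimensional _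

/-- An affine function is determined by its values at the vertexes of an element. -/
lemma affine_apply (ht : t ∈ M.elements) (f : EuclideanSpace ℝ (Fin 2) →ᵃ[ℝ] ℝ) (y) :
    f y = ∑ v ∈ t, M.bary t v y * f (M.pos v) := by
  have h := Finset.map_affineCombination t M.pos (fun v => M.bary t v y) (sum_bary ht y) f
  rw [Finset.affineCombination_eq_linear_combination _ _ _ (sum_bary ht y),
    Finset.affineCombination_eq_linear_combination _ _ _ (sum_bary ht y), sum_bary_smul ht] at h
  simpa using h

lemma bary_combination (ht : t ∈ M.elements) (hs : s ⊆ t) {w : V → ℝ} (hw : ∑ v ∈ s, w v = 1)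
    (hu : u ∈ t) : M.bary t u (∑ v ∈ s, w v • M.pos v) = if u ∈ s then w u else 0 := by
  have h := Finset.map_affineCombination s M.pos w hw (M.bary t u)
  rw [Finset.affineCombination_eq_linear_combination _ _ _ hw,
    Finset.affineCombination_eq_linear_combination _ _ _ hw] at h
  rw [h]
  have : ∀ v ∈ s, w v • (M.bary t u ∘ M.pos) v = if u = v then w v else 0 := fun v hv => by
    simp [bary_pos ht (hs hv) hu]
  rw [Finset.sum_congr rfl this]
  simp

lemma mem_openCell_iff (ht : t ∈ M.elements) (hs : s ⊆ t) :
    x ∈ M.openCell s ↔ (∀ v ∈ s, 0 < M.bary t v x) ∧ ∀ v ∈ t, v ∉ s → M.bary t v x = 0 := by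
  constructor
  · rintro ⟨w, hw, hw1, rfl⟩
    refine ⟨fun v hv => ?_, fun v hv hvs => ?_⟩
    · rw [bary_combination ht hs hw1 (hs hv), if_pos hv]; exact hw v hv
    · rw [bary_combination ht hs hw1 hv, if_neg hvs]
  · rintro ⟨h1, h2⟩
    refine ⟨fun v => M.bary t v x, h1, ?_, ?_⟩
    · rw [← sum_bary ht x]
      exact Finset.sum_subset hs h2
    · conv_lhs => rw [← sum_bary_smul ht x]
      refine (Finset.sum_subset hs fun v hv hvs => ?_).symm
      rw [h2 v hv hvs, zero_smul]

lemma mem_openCell_element (ht : t ∈ M.elements) :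
    x ∈ M.openCell t ↔ ∀ v ∈ t, 0 < M.bary t v x := by
  rw [mem_openCell_iff ht subset_rfl]
  exact ⟨fun h => h.1, fun h => ⟨h, fun v hv hv' => (hv' hv).elim⟩⟩

lemma face_unique (ht : t ∈ M.elements) (hs : s ⊆ t) (hs' : s' ⊆ t) (hx : x ∈ M.openCell s)
    (hx' : x ∈ M.openCell s') : s = s' := by
  rw [mem_openCell_iff ht hs] at hx
  rw [mem_openCell_iff ht hs'] at hx'
  ext v
  constructor
  · intro hv
    by_contra h
    exact (hx.1 v hv).ne' (hx'.2 v (hs hv) h)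
  · intro hv
    by_contra h
    exact (hx'.1 v hv).ne' (hx.2 v (hs' hv) h)

@[simp] lemma openCell_singleton (v : V) : M.openCell {v} = {M.pos v} := by
  ext x
  simp only [openCell, Finset.mem_singleton, forall_eq, Finset.sum_singleton, mem_ofPred_eq,
    mem_singleton_iff]
  constructor
  · rintro ⟨w, _, h, rfl⟩
    rw [h, one_smul]
  · rintro rfl
    exact ⟨fun _ => 1, by simp⟩

lemma isOpen_openCell (ht : t ∈ M.elements) : IsOpen (M.openCell t) := by
  have : M.openCell t = ⋂ v ∈ t, {x | 0 < M.bary t v x} := by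
    ext x
    simp [mem_openCell_element ht]
  rw [this]
  exact isOpen_biInter_finset fun v _ => isOpen_lt continuous_const (by fun_prop)

lemma openCell_subset_closure (ht : t ∈ M.elements) (hs : s ⊆ t) :
    M.openCell s ⊆ closure (M.openCell t) := by
  intro x hx
  obtain ⟨c, hc⟩ : (M.openCell t).Nonempty := by
    refine ⟨_, fun _ => 1 / 3, fun _ _ => by norm_num, ?_, rfl⟩
    simp [M.card_eq_three t ht]
  have h1 : Tendsto (fun ε : ℝ => AffineMap.lineMap x c ε) (𝓝[>] 0) (𝓝 x) := by
    have : Continuous (fun ε : ℝ => AffineMap.lineMap x c ε) := by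
      exact AffineMap.lineMap_continuous
    have := this.tendsto 0
    rw [AffineMap.lineMap_apply_zero] at this
    exact this.mono_left nhdsWithin_le_nhds
  refine mem_closure_of_tendsto h1 ?_
  have h2 : ∀ᶠ ε : ℝ in 𝓝[>] 0, ε ∈ Ioo (0 : ℝ) 1 := Ioo_mem_nhdsGT one_pos
  filter_upwards [h2] with ε hε
  rw [mem_openCell_element ht] at hc ⊢
  rw [mem_openCell_iff ht hs] at hx
  intro v hv
  rw [AffineMap.apply_lineMap, AffineMap.lineMap_apply_ring]
  have h3 : 0 ≤ M.bary t v x := by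
    by_cases h : v ∈ s
    · exact (hx.1 v h).le
    · exact (hx.2 v hv h).ge
  have := hc v hv
  have := mul_pos hε.1 this
  have : 0 ≤ (1 - ε) * M.bary t v x := mul_nonneg (by linarith [hε.2]) h3
  linarith

lemma element_unique (ht : t ∈ M.elements) (ht' : t' ∈ M.elements) (hx : x ∈ M.openCell t)
    (hx' : x ∈ M.openCell t') : t = t' := by
  by_contra h
  exact Set.disjoint_left.1 (M.disjoint_interiors t ht t' ht' h) hx hx'

/-- Elements whose open triangle meets a face of another one. -/
lemma eq_of_mem_face (ht : t ∈ M.elements) (ht' : t' ∈ M.elements) (hs : s ⊆ t')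
    (hx : x ∈ M.openCell t) (hx' : x ∈ M.openCell s) : t = t' ∧ s = t := by
  have : t = t' := by
    have h := openCell_subset_closure ht' hs hx'
    obtain ⟨y, hy, hy'⟩ := mem_closure_iff.1 h _ (isOpen_openCell ht) hx
    exact element_unique ht ht' hy hy'
  subst this
  exact ⟨rfl, face_unique ht hs subset_rfl hx' hx⟩

/-! ### Two elements on the two sides of an edge -/

lemma bary_eq_mul (ht : t ∈ M.elements) (ht' : t' ∈ M.elements) {a b c c' : V}
    (h : t = {a, b, c}) (h' : t' = {a, b, c'}) (hab : a ≠ b) (hac : a ≠ c) (hbc : b ≠ c)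
    (hac' : a ≠ c') (hbc' : b ≠ c') (y) :
    M.bary t c y = M.bary t c (M.pos c') * M.bary t' c' y := by
  rw [affine_apply ht' (M.bary t c) y, h', Finset.sum_insert (by simp [*]),
    Finset.sum_insert (by simp [*]), Finset.sum_singleton,
    bary_ne ht (by simp [h]) (by simp [h]) hac.symm, bary_ne ht (by simp [h]) (by simp [h]) hbc.symm]
  ring

lemma bary_opposite (ht : t ∈ M.elements) (ht' : t' ∈ M.elements) {a b c c' : V}
    (h : t = {a, b, c}) (h' : t' = {a, b, c'}) (hab : a ≠ b) (hac : a ≠ c) (hbc : b ≠ c)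
    (hac' : a ≠ c') (hbc' : b ≠ c') (hne : t ≠ t') : M.bary t c (M.pos c') < 0 := by
  have key := bary_eq_mul ht ht' h h' hab hac hbc hac' hbc'
  by_contra! hn
  rcases hn.eq_or_lt with h0 | hpos
  · have := key (M.pos c)
    rw [bary_self ht (by simp [h]), ← h0] at this
    simp at this
  · have hst : ({a, b} : Finset V) ⊆ t := by rw [h]; intro v; simp; tauto
    have hst' : ({a, b} : Finset V) ⊆ t' := by rw [h']; intro v; simp; tauto
    obtain ⟨m, hm⟩ : (M.openCell {a, b}).Nonempty := by
      refine ⟨_, fun _ => 1 / 2, fun _ _ => by norm_num, ?_, rfl⟩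
      simp [Finset.card_pair hab]
    have hcl := openCell_subset_closure ht' hst' hm
    rw [mem_openCell_iff ht hst] at hm
    have hU : IsOpen ({y | 0 < M.bary t a y} ∩ {y | 0 < M.bary t b y}) :=
      (isOpen_lt continuous_const (by fun_prop)).inter (isOpen_lt continuous_const (by fun_prop))
    obtain ⟨y, ⟨hya, hyb⟩, hy⟩ := mem_closure_iff.1 hcl _ hU ⟨hm.1 a (by simp), hm.1 b (by simp)⟩
    refine hne (element_unique ht ht' (x := y) ?_ hy)
    rw [mem_openCell_element ht' ] at hy
    rw [mem_openCell_element ht]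
    intro v hv
    rw [h] at hv
    simp only [Finset.mem_insert, Finset.mem_singleton] at hv
    rcases hv with rfl | rfl | rfl
    · exact hya
    · exact hyb
    · rw [key]; exact mul_pos hpos (hy c' (by simp [h']))

end


section

variable {V : Type*} [Fintype V] [DecidableEq V] {M : PlanarMesh V}
  {t t' s s' r e : Finset V} {x y : EuclideanSpace ℝ (Fin 2)} {u v : V}

/-! ### Internal cells -/

lemma exists_third (ht : t ∈ M.elements) {a b : V} (hab : a ≠ b) (h : {a, b} ⊆ t) :
    ∃ c, t = {a, b, c} ∧ a ≠ c ∧ b ≠ c := by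
  have hc : (t \ {a, b}).card = 1 := by
    rw [Finset.card_sdiff_of_subset h, M.card_eq_three t ht, Finset.card_pair hab]
  obtain ⟨c, hc⟩ := Finset.card_eq_one.1 hc
  have hc' : c ∈ t \ {a, b} := by rw [hc]; simp
  simp only [Finset.mem_sdiff, Finset.mem_insert, Finset.mem_singleton, not_or] at hc'
  refine ⟨c, ?_, fun h => hc'.2.1 h.symm, fun h => hc'.2.2 h.symm⟩
  rw [← Finset.sdiff_union_of_subset h, hc]
  ext v
  simp only [Finset.mem_union, Finset.mem_insert, Finset.mem_singleton]
  tauto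

lemma mem_edges : e ∈ M.edges ↔ ∃ t ∈ M.elements, e ⊆ t ∧ e.card = 2 := by
  simp [edges, Finset.mem_powersetCard]

lemma mem_edges_of_internal (he : e ∈ M.internalEdges) : e ∈ M.edges :=
  (Finset.mem_filter.1 he).1

lemma card_internalEdge (he : e ∈ M.internalEdges) : e.card = 2 := by
  obtain ⟨_, _, _, h⟩ := mem_edges.1 (mem_edges_of_internal he)
  exact h

/-- The other element that has a given internal edge. -/
lemma exists_neighbor (he : e ∈ M.internalEdges) (ht : t ∈ M.elements) (h : e ⊆ t) :
    ∃ t' ∈ M.elements, t ≠ t' ∧ e ⊆ t' ∧ ∀ t'' ∈ M.elements, e ⊆ t'' → t'' = t ∨ t'' = t' := by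
  obtain ⟨t₁, t₂, hne, h12⟩ := Finset.card_eq_two.1 (Finset.mem_filter.1 he).2
  have hmem : ∀ t'', (t'' ∈ M.elements ∧ e ⊆ t'') ↔ t'' = t₁ ∨ t'' = t₂ := fun t'' => by
    rw [← Finset.mem_filter (p := fun t => e ⊆ t), h12]
    simp
  rcases (hmem t).1 ⟨ht, h⟩ with rfl | rfl
  · obtain ⟨h1, h2⟩ := (hmem t₂).2 (Or.inr rfl)
    exact ⟨t₂, h1, hne, h2, fun t'' h1 h2 => (hmem t'').1 ⟨h1, h2⟩⟩
  · obtain ⟨h1, h2⟩ := (hmem t₁).2 (Or.inl rfl)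
    exact ⟨t₁, h1, hne.symm, h2, fun t'' h1 h2 => ((hmem t'').1 ⟨h1, h2⟩).symm⟩

/-- The cells whose union is the domain. -/
def IsInternal (M : PlanarMesh V) (s : Finset V) : Prop :=
  s ∈ M.elements ∨ s ∈ M.internalEdges ∨ ∃ v ∈ M.internalVertices, s = {v}

lemma mem_domain : x ∈ M.domain ↔ ∃ s, M.IsInternal s ∧ x ∈ M.openCell s := by
  simp only [domain, IsInternal, mem_union, mem_iUnion, exists_prop, mem_singleton_iff]
  constructor
  · rintro ((⟨s, hs, hx⟩ | ⟨s, hs, hx⟩) | ⟨v, hv, hx⟩)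
    · exact ⟨s, Or.inl hs, hx⟩
    · exact ⟨s, Or.inr (Or.inl hs), hx⟩
    · exact ⟨{v}, Or.inr (Or.inr ⟨v, hv, rfl⟩), by simpa using hx⟩
  · rintro ⟨s, hs | hs | ⟨v, hv, rfl⟩, hx⟩
    · exact Or.inl (Or.inl ⟨s, hs, hx⟩)
    · exact Or.inl (Or.inr ⟨s, hs, hx⟩)
    · exact Or.inr ⟨v, hv, by simpa using hx⟩

lemma edge_internal_of_vertex (hv : v ∈ M.internalVertices) (he : e ∈ M.edges) (hve : v ∈ e) :
    e ∈ M.internalEdges := by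
  by_contra h
  simp only [internalVertices, boundaryVertices, Finset.mem_sdiff, Finset.mem_univ, true_and,
    Finset.mem_filter, not_exists, not_and] at hv
  exact hv e (Finset.mem_sdiff.2 ⟨he, h⟩) hve

lemma IsInternal.exists_element (hs : M.IsInternal s) : ∃ t ∈ M.elements, s ⊆ t := by
  rcases hs with hs | hs | ⟨v, hv, rfl⟩
  · exact ⟨s, hs, subset_rfl⟩
  · obtain ⟨t, ht, h, _⟩ := mem_edges.1 (mem_edges_of_internal hs)
    exact ⟨t, ht, h⟩
  · obtain ⟨t, ht, h⟩ := M.exists_element v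
    exact ⟨t, ht, by simpa using h⟩

lemma IsInternal.mono (hs : M.IsInternal s) (ht : t ∈ M.elements) (hsr : s ⊆ r) (hrt : r ⊆ t) :
    M.IsInternal r := by
  have h3 := M.card_eq_three t ht
  have hr3 := Finset.card_le_card hrt
  have heq : 3 ≤ r.card → r = t := fun h => Finset.eq_of_subset_of_card_le hrt (by omega)
  have hsr' := Finset.card_le_card hsr
  rcases hs with hs | hs | ⟨v, hv, rfl⟩
  · left
    rw [heq (by rw [M.card_eq_three s hs] at hsr'; exact hsr')]
    exact ht
  · rw [card_internalEdge hs] at hsr'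
    rcases hsr'.eq_or_lt with h | h
    · rw [Finset.eq_of_subset_of_card_le hsr (by rw [card_internalEdge hs, h])] at hs
      exact Or.inr (Or.inl hs)
    · rw [heq h]; exact Or.inl ht
  · rw [Finset.card_singleton] at hsr'
    by_cases h1 : r.card = 1
    · rw [← Finset.eq_of_subset_of_card_le hsr (by simp [h1])]
      exact Or.inr (Or.inr ⟨v, hv, rfl⟩)
    by_cases h2 : r.card = 2
    · exact Or.inr (Or.inl (edge_internal_of_vertex hv (mem_edges.2 ⟨t, ht, hrt, h2⟩)
        (hsr (by simp))))
    · rw [heq (by omega)]; exact Or.inl ht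

/-- A property of the elements that is transmitted across the internal edges. -/
def Invariant (M : PlanarMesh V) (P : Finset V → Prop) : Prop :=
  ∀ e ∈ M.internalEdges, ∀ t ∈ M.elements, ∀ t' ∈ M.elements, e ⊆ t → e ⊆ t' → P t → P t'

variable {P : Finset V → Prop}

/-- The set filled by the elements at an internal vertex and by their continuations beyond the
opposite edges. -/
def coneSet (M : PlanarMesh V) (P : Finset V → Prop) (u : V) : Set (EuclideanSpace ℝ (Fin 2)) :=
  {y | ∃ t ∈ M.elements, u ∈ t ∧ P t ∧ ∀ v ∈ t, v ≠ u → 0 ≤ M.bary t v y}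

lemma isClosed_coneSet (P : Finset V → Prop) (u : V) : IsClosed (M.coneSet P u) := by
  have : M.coneSet P u = ⋃ t ∈ {t | t ∈ M.elements ∧ u ∈ t ∧ P t},
      ⋂ v ∈ {v | v ∈ t ∧ v ≠ u}, {y | 0 ≤ M.bary t v y} := by
    ext y
    simp [coneSet, and_assoc]
  rw [this]
  refine (Set.toFinite _).isClosed_biUnion fun t _ => isClosed_biInter fun v _ => ?_
  exact isClosed_le continuous_const (by fun_prop)

lemma side_cover (ht : t ∈ M.elements) (ht' : t' ∈ M.elements) {a b c c' : V}
    (h : t = {a, b, c}) (h' : t' = {a, b, c'}) (hab : a ≠ b) (hac : a ≠ c) (hbc : b ≠ c)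
    (hac' : a ≠ c') (hbc' : b ≠ c') (hne : t ≠ t') (y) :
    0 ≤ M.bary t c y ∨ 0 ≤ M.bary t' c' y := by
  have h1 := bary_eq_mul ht ht' h h' hab hac hbc hac' hbc' y
  have h2 := bary_opposite ht ht' h h' hab hac hbc hac' hbc' hne
  by_contra! hn
  have := mul_pos_of_neg_of_neg h2 hn.2
  linarith [hn.1]

lemma bary_eq_of_edge (ht : t ∈ M.elements) (ht' : t' ∈ M.elements) {a b c : V}
    (h : t = {a, b, c}) (ha' : a ∈ t') (hb' : b ∈ t') (hab : a ≠ b) (hac : a ≠ c)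
    (hbc : b ≠ c) (hy : M.bary t c y = 0) : M.bary t' b y = M.bary t b y := by
  rw [affine_apply ht (M.bary t' b) y, h, Finset.sum_insert (by simp [*]),
    Finset.sum_insert (by simp [*]), Finset.sum_singleton, bary_ne ht' ha' hb' hab.symm,
    bary_self ht' hb', ← h, hy]
  ring

lemma coneSet_mem_nhds (hP : M.Invariant P) (hu : u ∈ M.internalVertices)
    (hy : y ∈ M.coneSet P u) (hyu : y ≠ M.pos u) : M.coneSet P u ∈ 𝓝 y := by
  obtain ⟨t, ht, hut, hPt, hcone⟩ := hy
  have hev : ∀ (t : Finset V) (v : V), 0 < M.bary t v y → ∀ᶠ z in 𝓝 y, 0 ≤ M.bary t v z :=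
    fun t v h => ((continuous_bary t v).continuousAt.eventually_const_lt h).mono fun z hz => hz.le
  by_cases hall : ∀ v ∈ t, v ≠ u → 0 < M.bary t v y
  · have : ∀ᶠ z in 𝓝 y, ∀ v ∈ t, v ≠ u → 0 ≤ M.bary t v z := by
      rw [Filter.eventually_all_finset]
      intro v hv
      by_cases hvu : v = u
      · simp [hvu]
      · filter_upwards [hev t v (hall v hv hvu)] with z hz _ using hz
    filter_upwards [this] with z hz using ⟨t, ht, hut, hPt, hz⟩
  · push Not at hall
    obtain ⟨c, hct, hcu, hc0⟩ := hall
    have hc0 : M.bary t c y = 0 := le_antisymm hc0 (hcone c hct hcu)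
    obtain ⟨b, htb, hub, hcb⟩ := exists_third ht (a := u) (b := c) hcu.symm
      (by intro v; simp only [Finset.mem_insert, Finset.mem_singleton]; rintro (rfl | rfl) <;> assumption)
    have htb' : t = {u, b, c} := by rw [htb]; ext; simp; tauto
    have hbt : b ∈ t := by simp [htb]
    have hb0 : 0 < M.bary t b y := by
      refine (hcone b hbt hub.symm).lt_of_ne fun h0 => hyu ?_
      have h1 := sum_bary_smul ht y
      have h2 := sum_bary ht y
      rw [htb', Finset.sum_insert (by simp [*, hcu.symm]), Finset.sum_insert (by simp [hcb.symm]),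
        Finset.sum_singleton, ← htb', hc0, ← h0] at h1 h2
      simp only [add_zero] at h2
      simpa [h2] using h1.symm
    have he : ({u, b} : Finset V) ⊆ t := by rw [htb']; intro v; simp; tauto
    have hin : ({u, b} : Finset V) ∈ M.internalEdges :=
      edge_internal_of_vertex hu (mem_edges.2 ⟨t, ht, he, Finset.card_pair hub⟩) (by simp)
    obtain ⟨t', ht', hne, he', _⟩ := exists_neighbor hin ht he
    obtain ⟨c', htc', huc', hbc'⟩ := exists_third ht' hub he'
    have hb0' : 0 < M.bary t' b y := by
      rwa [bary_eq_of_edge ht ht' htb' (he' (by simp)) (he' (by simp)) hub hcu.symm hcb.symm hc0]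
    filter_upwards [hev t b hb0, hev t' b hb0'] with z hz hz'
    rcases side_cover ht ht' htb' htc' hub hcu.symm hcb.symm huc' hbc' hne z with h | h
    · refine ⟨t, ht, hut, hPt, fun v hv hvu => ?_⟩
      rw [htb'] at hv
      simp only [Finset.mem_insert, Finset.mem_singleton] at hv
      rcases hv with rfl | rfl | rfl
      · exact (hvu rfl).elim
      · exact hz
      · exact h
    · refine ⟨t', ht', he' (by simp), hP _ hin t ht t' ht' he he' hPt, fun v hv hvu => ?_⟩
      rw [htc'] at hv
      simp only [Finset.mem_insert, Finset.mem_singleton] at hv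
      rcases hv with rfl | rfl | rfl
      · exact (hvu rfl).elim
      · exact hz'
      · exact h

lemma coneSet_eq_univ (hP : M.Invariant P) (hu : u ∈ M.internalVertices) (ht : t ∈ M.elements)
    (hut : u ∈ t) (hPt : P t) : M.coneSet P u = univ := by
  have hpre : IsPreconnected ({M.pos u}ᶜ : Set (EuclideanSpace ℝ (Fin 2))) := by
    refine (isConnected_compl_singleton_of_one_lt_rank ?_ _).isPreconnected
    rw [← Module.finrank_eq_rank]
    simp
  have hmem : ∀ v ∈ t, M.pos v ∈ M.coneSet P u := fun v hv =>
    ⟨t, ht, hut, hPt, fun v' hv' _ => by rw [bary_pos ht hv hv']; split_ifs <;> norm_num⟩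
  have hsub : ({M.pos u}ᶜ : Set (EuclideanSpace ℝ (Fin 2))) ⊆ M.coneSet P u \ {M.pos u} := by
    apply hpre.subset_of_closure_inter_subset
    · rw [isOpen_iff_mem_nhds]
      rintro y ⟨hy, hyu⟩
      exact inter_mem (coneSet_mem_nhds hP hu hy hyu) (isOpen_compl_singleton.mem_nhds hyu)
    · obtain ⟨v, hv, hvu⟩ := Finset.exists_mem_ne
        (show 1 < t.card by rw [M.card_eq_three t ht]; norm_num) u
      have : M.pos v ≠ M.pos u := fun h => by
        have := bary_ne ht hut hv hvu
        rw [← h, bary_self ht hv] at this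
        exact one_ne_zero this
      exact ⟨M.pos v, this, hmem v hv, this⟩
    · rintro y ⟨hy, hyu⟩
      exact ⟨(isClosed_coneSet P u).closure_subset_iff.2 sdiff_subset hy, hyu⟩
  rw [eq_univ_iff_forall]
  intro y
  by_cases hy : y = M.pos u
  · rw [hy]; exact hmem u hut
  · exact (hsub hy).1

/-- The elements having an internal cell as a face cover a neighborhood of it. -/
lemma eventually_mem_star (hP : M.Invariant P) (hs : M.IsInternal s) (ht : t ∈ M.elements)
    (hst : s ⊆ t) (hPt : P t) (hx : x ∈ M.openCell s) :
    ∀ᶠ y in 𝓝 x, ∃ t' ∈ M.elements, ∃ r, s ⊆ r ∧ r ⊆ t' ∧ P t' ∧ y ∈ M.openCell r := by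
  have hpos : ∀ᶠ y in 𝓝 x, ∀ t' ∈ M.elements, s ⊆ t' → ∀ v ∈ s, 0 < M.bary t' v y := by
    rw [Filter.eventually_all_finset]
    intro t' ht'
    by_cases hst' : s ⊆ t'
    · have : ∀ᶠ y in 𝓝 x, ∀ v ∈ s, 0 < M.bary t' v y := by
        rw [Filter.eventually_all_finset]
        intro v hv
        exact (continuous_bary t' v).continuousAt.eventually_const_lt
          (((mem_openCell_iff ht' hst').1 hx).1 v hv)
      filter_upwards [this] with y hy _ using hy
    · simp [hst']
  have hcov : ∀ᶠ y in 𝓝 x, (∀ t' ∈ M.elements, s ⊆ t' → ∀ v ∈ s, 0 < M.bary t' v y) →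
      ∃ t' ∈ M.elements, s ⊆ t' ∧ P t' ∧ ∀ v ∈ t', 0 ≤ M.bary t' v y := by
    rcases hs with hs | hs | ⟨u, hu, rfl⟩
    · exact Eventually.of_forall fun y hy =>
        ⟨s, hs, subset_rfl, by
          rwa [Finset.eq_of_subset_of_card_le hst (by rw [M.card_eq_three s hs, M.card_eq_three t ht])],
          fun v hv => (hy s hs subset_rfl v hv).le⟩
    · obtain ⟨t', ht', hne, hst', _⟩ := exists_neighbor hs ht hst
      obtain ⟨a, b, hab, rfl⟩ := Finset.card_eq_two.1 (card_internalEdge hs)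
      obtain ⟨c, hc, hac, hbc⟩ := exists_third ht hab hst
      obtain ⟨c', hc', hac', hbc'⟩ := exists_third ht' hab hst'
      refine Eventually.of_forall fun y hy => ?_
      rcases side_cover ht ht' hc hc' hab hac hbc hac' hbc' hne y with h | h
      · refine ⟨t, ht, hst, hPt, fun v hv => ?_⟩
        by_cases hvs : v ∈ ({a, b} : Finset V)
        · exact (hy t ht hst v hvs).le
        · rw [hc] at hv
          simp only [Finset.mem_insert, Finset.mem_singleton] at hv hvs
          obtain rfl : v = c := by tauto
          exact h
      · refine ⟨t', ht', hst', hP _ hs t ht t' ht' hst hst' hPt, fun v hv => ?_⟩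
        by_cases hvs : v ∈ ({a, b} : Finset V)
        · exact (hy t' ht' hst' v hvs).le
        · rw [hc'] at hv
          simp only [Finset.mem_insert, Finset.mem_singleton] at hv hvs
          obtain rfl : v = c' := by tauto
          exact h
    · refine Eventually.of_forall fun y hy => ?_
      have : y ∈ M.coneSet P u := by
        rw [coneSet_eq_univ hP hu ht (by simpa using hst) hPt]; trivial
      obtain ⟨t', ht', hut', hPt', hc⟩ := this
      have hst' : {u} ⊆ t' := by simpa using hut'
      refine ⟨t', ht', hst', hPt', fun v hv => ?_⟩
      by_cases hvu : v = u
      · exact (hy t' ht' hst' v (by simp [hvu])).le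
      · exact hc v hv hvu
  filter_upwards [hpos, hcov] with y hy hy'
  obtain ⟨t', ht', hst', hPt', h⟩ := hy' hy
  refine ⟨t', ht', t'.filter (fun v => 0 < M.bary t' v y), fun v hv => ?_,
    Finset.filter_subset _ _, hPt', ?_⟩
  · exact Finset.mem_filter.2 ⟨hst' hv, hy t' ht' hst' v hv⟩
  · rw [mem_openCell_iff ht' (Finset.filter_subset _ _)]
    refine ⟨fun v hv => (Finset.mem_filter.1 hv).2, fun v hv hv' => ?_⟩
    rw [Finset.mem_filter, not_and] at hv'
    exact le_antisymm (not_lt.1 (hv' hv)) (h v hv)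

/-- If an internal cell has a common point with a face of an element, this element is in the
star of the cell. -/
lemma star_of_meet (hP : M.Invariant P) (hs : M.IsInternal s) (ht : t ∈ M.elements)
    (hst : s ⊆ t) (hPt : P t) (hx : x ∈ M.openCell s) (ht' : t' ∈ M.elements) (hs' : s' ⊆ t')
    (hx' : x ∈ M.openCell s') : s ⊆ t' ∧ P t' := by
  have h1 := openCell_subset_closure ht' hs' hx'
  obtain ⟨y, ⟨t'', ht'', r, hsr, hrt, hP'', hyr⟩, hy⟩ := mem_closure_iff_nhds.1 h1 _
    (eventually_mem_star hP hs ht hst hPt hx)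
  obtain ⟨rfl, rfl⟩ := eq_of_mem_face ht' ht'' hrt hy hyr
  exact ⟨hsr, hP''⟩

lemma invariant_true : M.Invariant fun _ => True := fun _ _ _ _ _ _ _ _ _ => trivial

/-- An internal cell is disjoint from all the other cells. -/
lemma internal_unique (hs : M.IsInternal s) (hx : x ∈ M.openCell s) (ht' : t' ∈ M.elements)
    (hs' : s' ⊆ t') (hx' : x ∈ M.openCell s') : s = s' := by
  obtain ⟨t, ht, hst⟩ := hs.exists_element
  exact face_unique ht' (star_of_meet invariant_true hs ht hst trivial hx ht' hs' hx').1 hs' hx hx'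

lemma isOpen_domain : IsOpen M.domain := by
  rw [isOpen_iff_mem_nhds]
  intro x hx
  obtain ⟨s, hs, hx⟩ := mem_domain.1 hx
  obtain ⟨t, ht, hst⟩ := hs.exists_element
  filter_upwards [eventually_mem_star invariant_true hs ht hst trivial hx] with y hy
  obtain ⟨t', ht', r, hsr, hrt, -, hy⟩ := hy
  exact mem_domain.2 ⟨r, hs.mono ht' hsr hrt, hy⟩

/-- The points of the domain in the star of the elements having a given property. -/
def subdomain (M : PlanarMesh V) (P : Finset V → Prop) : Set (EuclideanSpace ℝ (Fin 2)) :=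
  {x | ∃ s, M.IsInternal s ∧ x ∈ M.openCell s ∧ ∃ t ∈ M.elements, s ⊆ t ∧ P t}

lemma isOpen_subdomain (hP : M.Invariant P) : IsOpen (M.subdomain P) := by
  rw [isOpen_iff_mem_nhds]
  rintro x ⟨s, hs, hx, t, ht, hst, hPt⟩
  filter_upwards [eventually_mem_star hP hs ht hst hPt hx] with y hy
  obtain ⟨t', ht', r, hsr, hrt, hPt', hy⟩ := hy
  exact ⟨r, hs.mono ht' hsr hrt, hy, t', ht', hrt, hPt'⟩

lemma openCell_nonempty (ht : t ∈ M.elements) : (M.openCell t).Nonempty := by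
  refine ⟨_, fun _ => 1 / 3, fun _ _ => by norm_num, ?_, rfl⟩
  simp [M.card_eq_three t ht]

/-- A function on the elements that does not jump across the internal edges is constant. -/
lemma eq_of_jump_zero (hconn : IsConnected M.domain) {α : Type*} (f : Finset V → α)
    (hf : ∀ e ∈ M.internalEdges, ∀ t ∈ M.elements, ∀ t' ∈ M.elements, e ⊆ t → e ⊆ t' → f t = f t')
    (ht : t ∈ M.elements) (ht' : t' ∈ M.elements) : f t = f t' := by
  have h1 : M.Invariant (fun r => f r = f t) := fun e he a ha b hb hea heb h =>
    (hf e he a ha b hb hea heb).symm.trans h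
  have h2 : M.Invariant (fun r => f r ≠ f t) := fun e he a ha b hb hea heb h =>
    fun hb' => h ((hf e he a ha b hb hea heb).trans hb')
  by_contra hne
  obtain ⟨x, hx⟩ := openCell_nonempty ht
  obtain ⟨x', hx'⟩ := openCell_nonempty ht'
  have hcov : M.domain ⊆ M.subdomain (fun r => f r = f t) ∪ M.subdomain (fun r => f r ≠ f t) := by
    intro y hy
    obtain ⟨s, hs, hy⟩ := mem_domain.1 hy
    obtain ⟨r, hr, hsr⟩ := hs.exists_element
    by_cases h : f r = f t
    · exact Or.inl ⟨s, hs, hy, r, hr, hsr, h⟩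
    · exact Or.inr ⟨s, hs, hy, r, hr, hsr, h⟩
  obtain ⟨y, -, ⟨s, hs, hy, r, hr, hsr, h⟩, ⟨s', hs', hy', r', hr', hsr', h'⟩⟩ :=
    hconn.isPreconnected _ _ (isOpen_subdomain h1) (isOpen_subdomain h2) hcov
      ⟨x, mem_domain.2 ⟨t, Or.inl ht, hx⟩, t, Or.inl ht, hx, t, ht, subset_rfl, rfl⟩
      ⟨x', mem_domain.2 ⟨t', Or.inl ht', hx'⟩, t', Or.inl ht', hx', t', ht', subset_rfl,
        fun h => hne h.symm⟩
  exact h' (star_of_meet h1 hs hr hsr h hy hr' hsr' hy').2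

end


section

variable {V : Type*} [Fintype V] [DecidableEq V] {M : PlanarMesh V}
  {t t' s s' r e : Finset V} {x y : EuclideanSpace ℝ (Fin 2)} {u v a b c : V}

/-! ### The complement of the domain -/

lemma IsInternal.of_card_two (hs : M.IsInternal s) (h : s.card = 2) : s ∈ M.internalEdges := by
  rcases hs with hs | hs | ⟨v, hv, rfl⟩
  · have := M.card_eq_three s hs
    omega
  · exact hs
  · simp at h

lemma pos_mem_domain : M.pos v ∈ M.domain ↔ v ∈ M.internalVertices := by
  constructor
  · intro h
    obtain ⟨s, hs, hx⟩ := mem_domain.1 h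
    obtain ⟨t, ht, hvt⟩ := M.exists_element v
    have h1 := internal_unique hs hx ht (s' := {v}) (by simpa using hvt) (by simp)
    subst h1
    rcases hs with hs | hs | ⟨w, hw, h⟩
    · simpa using M.card_eq_three _ hs
    · simpa using card_internalEdge hs
    · rwa [Finset.singleton_injective h]
  · intro h
    exact mem_domain.2 ⟨{v}, Or.inr (Or.inr ⟨v, h, rfl⟩), by simp⟩

lemma segment_subset_compl (he : {a, b} ∈ M.edges) (hab : a ≠ b) (hi : {a, b} ∉ M.internalEdges) :
    segment ℝ (M.pos a) (M.pos b) ⊆ M.domainᶜ := by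
  have hend : ∀ v ∈ ({a, b} : Finset V), M.pos v ∈ M.domainᶜ := fun v hv h =>
    hi (edge_internal_of_vertex (pos_mem_domain.1 h) he hv)
  obtain ⟨t, ht, het, -⟩ := mem_edges.1 he
  intro x hx
  rw [← insert_endpoints_openSegment] at hx
  rcases hx with rfl | rfl | ⟨p, q, hp, hq, hpq, rfl⟩
  · exact hend a (by simp)
  · exact hend b (by simp)
  · intro h
    obtain ⟨s, hs, hx⟩ := mem_domain.1 h
    have h1 := internal_unique hs hx ht het
      ⟨fun v => if v = a then p else q, fun v _ => by dsimp only; split_ifs <;> assumption,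
        by simp [Finset.sum_pair hab, hab.symm, hpq], by simp [Finset.sum_pair hab, hab.symm]⟩
    subst h1
    exact hi (hs.of_card_two (Finset.card_pair hab))

lemma component_eq (he : {a, b} ∈ M.edges) (hab : a ≠ b) (hi : {a, b} ∉ M.internalEdges) :
    connectedComponentIn M.domainᶜ (M.pos a) = connectedComponentIn M.domainᶜ (M.pos b) := by
  apply connectedComponentIn_eq
  exact (convex_segment _ _).isPreconnected.subset_connectedComponentIn
    (left_mem_segment ℝ _ _) (segment_subset_compl he hab hi) (right_mem_segment ℝ _ _)

/-! ### Orientation -/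

lemma cross_eq_bary_mul (ht : t ∈ M.elements) (h : t = {a, b, c}) (hab : a ≠ b) (hac : a ≠ c)
    (hbc : b ≠ c) (y) : cross (M.pos b - M.pos a) (y - M.pos a) =
      M.bary t c y * cross (M.pos b - M.pos a) (M.pos c - M.pos a) := by
  have h1 := sum_bary ht y
  have h2 := sum_bary_smul ht y
  rw [h, Finset.sum_insert (by simp [*]), Finset.sum_insert (by simp [*]),
    Finset.sum_singleton, ← h] at h1 h2
  have h3 : M.bary t a y = 1 - M.bary t b y - M.bary t c y := by linarith
  conv_lhs => rw [← h2]
  simp only [cross, PiLp.sub_apply, PiLp.add_apply, PiLp.smul_apply, smul_eq_mul, h3]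
  ring

lemma cross_ne_zero (ht : t ∈ M.elements) (h : t = {a, b, c}) (hab : a ≠ b) (hac : a ≠ c)
    (hbc : b ≠ c) : cross (M.pos b - M.pos a) (M.pos c - M.pos a) ≠ 0 := by
  intro h0
  have key := cross_eq_bary_mul ht h hab hac hbc
  simp only [h0, mul_zero] at key
  have h1 := key (M.pos a + !₂[-((M.pos b - M.pos a) 1), (M.pos b - M.pos a) 0])
  simp only [cross, add_sub_cancel_left, PiLp.sub_apply, Matrix.cons_val_zero,
    Matrix.cons_val_one] at h1
  have h2 : M.pos b 0 - M.pos a 0 = 0 := by nlinarith [sq_nonneg (M.pos b 1 - M.pos a 1)]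
  have h3 : M.pos b 1 - M.pos a 1 = 0 := by nlinarith [sq_nonneg (M.pos b 0 - M.pos a 0)]
  have h4 : M.pos b = M.pos a := by
    ext i
    fin_cases i
    · simpa using sub_eq_zero.1 h2
    · simpa using sub_eq_zero.1 h3
  have h5 := bary_ne ht (u := a) (v := b) (by simp [h]) (by simp [h]) hab.symm
  rw [← h4, bary_self ht (by simp [h])] at h5
  exact one_ne_zero h5

/-- `t` is the triangle with vertexes `a, b, c`, in counter-clockwise order. -/
structure IsCcw (M : PlanarMesh V) (t : Finset V) (a b c : V) : Prop where
  mem : t ∈ M.elements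
  eq : t = {a, b, c}
  ab : a ≠ b
  ac : a ≠ c
  bc : b ≠ c
  cross_pos : 0 < cross (M.pos b - M.pos a) (M.pos c - M.pos a)

lemma IsCcw.rotate (h : M.IsCcw t a b c) : M.IsCcw t b c a where
  mem := h.mem
  eq := by rw [h.eq]; ext; simp; tauto
  ab := h.bc
  ac := h.ab.symm
  bc := h.ac.symm
  cross_pos := by
    have := h.cross_pos
    simp only [cross, PiLp.sub_apply] at this ⊢
    linarith

lemma exists_isCcw (ht : t ∈ M.elements) : ∃ a b c, M.IsCcw t a b c := by
  obtain ⟨a, b, c, hab, hac, hbc, h⟩ := Finset.card_eq_three.1 (M.card_eq_three t ht)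
  rcases (cross_ne_zero ht h hab hac hbc).lt_or_gt with h0 | h0
  · refine ⟨b, a, c, ht, by rw [h]; ext; simp; tauto, hab.symm, hbc, hac, ?_⟩
    simp only [cross, PiLp.sub_apply] at h0 ⊢
    linarith
  · exact ⟨a, b, c, ht, h, hab, hac, hbc, h0⟩

lemma IsCcw.edge_subset (h : M.IsCcw t a b c) : {a, b} ⊆ t := by
  rw [h.eq]; intro v; simp; tauto

lemma IsCcw.edge_mem (h : M.IsCcw t a b c) : {a, b} ∈ M.edges :=
  mem_edges.2 ⟨t, h.mem, h.edge_subset, Finset.card_pair h.ab⟩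

lemma IsCcw.edge_cases (h : M.IsCcw t a b c) (he : e ⊆ t) (he2 : e.card = 2) :
    e = {a, b} ∨ e = {b, c} ∨ e = {c, a} := by
  obtain ⟨p, q, hpq, rfl⟩ := Finset.card_eq_two.1 he2
  have hp := he (show p ∈ ({p, q} : Finset V) by simp)
  have hq := he (show q ∈ ({p, q} : Finset V) by simp)
  rw [h.eq] at hp hq
  simp only [Finset.mem_insert, Finset.mem_singleton] at hp hq
  rcases hp with rfl | rfl | rfl <;> rcases hq with rfl | rfl | rfl <;>
    first
    | exact (hpq rfl).elim
    | simp
    | (rw [Finset.pair_comm]; simp)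

variable (o : M.EdgeOrientation)

lemma tail_ne_head (he : e ∈ M.internalEdges) : o.tail e ≠ o.head e := by
  intro h
  have h1 := o.ends e he
  have h2 := card_internalEdge he
  rw [h1, h] at h2
  simp at h2

lemma delta_of_not_subset (h : ¬ e ⊆ t) : M.delta o t e = 0 := by
  rw [delta, if_neg h]

lemma delta_eq (h : t = {a, b, c}) (hac : a ≠ c) (hbc : b ≠ c) :
    M.delta o t {a, b} = Real.sign (cross (M.pos (o.head {a, b}) - M.pos (o.tail {a, b}))
      (M.pos c - M.pos (o.tail {a, b}))) := by
  have h1 : ({a, b} : Finset V) ⊆ t := by rw [h]; intro v; simp; tauto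
  have h2 : t \ {a, b} = {c} := by
    rw [h]; ext v
    simp only [Finset.mem_sdiff, Finset.mem_insert, Finset.mem_singleton]
    constructor
    · tauto
    · rintro rfl; simp [hac.symm, hbc.symm]
  rw [delta, if_pos h1, h2, Finset.sum_singleton]

lemma ends_cases (hab : a ≠ b) (he : {a, b} ∈ M.internalEdges) :
    (o.tail {a, b} = a ∧ o.head {a, b} = b) ∨ (o.tail {a, b} = b ∧ o.head {a, b} = a) := by
  have h1 := o.ends _ he
  have h2 := tail_ne_head o he
  set p := o.tail {a, b}
  set q := o.head {a, b}
  have ha : a ∈ ({p, q} : Finset V) := by rw [← h1]; simp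
  have hb : b ∈ ({p, q} : Finset V) := by rw [← h1]; simp
  simp only [Finset.mem_insert, Finset.mem_singleton] at ha hb
  rcases ha with ha | ha <;> rcases hb with hb | hb
  · exact (hab (ha.trans hb.symm)).elim
  · exact Or.inl ⟨ha.symm, hb.symm⟩
  · exact Or.inr ⟨hb.symm, ha.symm⟩
  · exact (hab (ha.trans hb.symm)).elim

lemma IsCcw.delta_cases (h : M.IsCcw t a b c) (he : {a, b} ∈ M.internalEdges) :
    (o.tail {a, b} = a ∧ o.head {a, b} = b ∧ M.delta o t {a, b} = 1) ∨
    (o.tail {a, b} = b ∧ o.head {a, b} = a ∧ M.delta o t {a, b} = -1) := by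
  rw [delta_eq o h.eq h.ac h.bc]
  have := h.cross_pos
  rcases ends_cases o h.ab he with ⟨h1, h2⟩ | ⟨h1, h2⟩
  · refine Or.inl ⟨h1, h2, ?_⟩
    rw [h1, h2, Real.sign_of_pos this]
  · refine Or.inr ⟨h1, h2, ?_⟩
    rw [h1, h2, Real.sign_of_neg]
    simp only [cross, PiLp.sub_apply] at this ⊢
    linarith

lemma delta_neighbor (he : e ∈ M.internalEdges) (ht : t ∈ M.elements) (ht' : t' ∈ M.elements)
    (hne : t ≠ t') (h : e ⊆ t) (h' : e ⊆ t') :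
    M.delta o t' e = -M.delta o t e ∧ M.delta o t e ≠ 0 := by
  obtain ⟨a, b, hab, hab', rfl⟩ : ∃ a b, a ≠ b ∧ (o.tail e = a ∧ o.head e = b) ∧ e = {a, b} :=
    ⟨_, _, tail_ne_head o he, ⟨rfl, rfl⟩, o.ends e he⟩
  obtain ⟨c, hc, hac, hbc⟩ := exists_third ht hab h
  obtain ⟨c', hc', hac', hbc'⟩ := exists_third ht' hab h'
  rw [delta_eq o hc hac hbc, delta_eq o hc' hac' hbc', hab'.1, hab'.2,
    cross_eq_bary_mul ht hc hab hac hbc (M.pos c')]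
  have hneg := bary_opposite ht ht' hc hc' hab hac hbc hac' hbc' hne
  have h0 := cross_ne_zero ht hc hab hac hbc
  refine ⟨?_, by simpa [Real.sign_eq_zero_iff] using h0⟩
  rcases h0.lt_or_gt with h0 | h0
  · rw [Real.sign_of_neg h0, Real.sign_of_pos (mul_pos_of_neg_of_neg hneg h0), neg_neg]
  · rw [Real.sign_of_pos h0, Real.sign_of_neg (mul_neg_of_neg_of_pos hneg h0)]

/-- Summing over the elements that have a given internal edge. -/
lemma sum_delta_mul {R : Type*} [CommRing R] [Algebra ℝ R] (he : e ∈ M.internalEdges)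
    (ht : t ∈ M.elements) (ht' : t' ∈ M.elements)
    (hne : t ≠ t') (h : e ⊆ t) (h' : e ⊆ t') (f : Finset V → R) :
    ∑ r ∈ M.elements, M.delta o r e • f r = M.delta o t e • (f t - f t') := by
  have hsub : ({t, t'} : Finset (Finset V)) ⊆ M.elements := by
    intro r; simp only [Finset.mem_insert, Finset.mem_singleton]; rintro (rfl | rfl) <;> assumption
  rw [← Finset.sum_subset hsub, Finset.sum_pair hne, (delta_neighbor o he ht ht' hne h h').1]
  · rw [neg_smul, smul_sub, sub_eq_add_neg]
  · intro r hr hr'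
    rw [delta_of_not_subset, zero_smul]
    intro hre
    obtain ⟨t'', ht'', hne'', h'', hall⟩ := exists_neighbor he ht h
    have h1 : t'' = t' := ((hall t' ht' h').resolve_left hne.symm).symm
    rcases hall r hr hre with rfl | rfl <;> simp [h1] at hr'

lemma sum_delta_const {R : Type*} [CommRing R] [Algebra ℝ R] (he : e ∈ M.internalEdges) (k : R) :
    ∑ r ∈ M.elements, M.delta o r e • k = 0 := by
  obtain ⟨t, ht, h, _⟩ := mem_edges.1 (mem_edges_of_internal he)
  obtain ⟨t', ht', hne, h', -⟩ := exists_neighbor he ht h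
  rw [sum_delta_mul o he ht ht' hne h h', sub_self, smul_zero]

/-! ### The rank -/

lemma rank_incidence (hconn : IsConnected M.domain) :
    (M.incidence o).rank + 1 = M.elements.card := by
  obtain ⟨x, hx⟩ := hconn.nonempty
  obtain ⟨s, hs, -⟩ := mem_domain.1 hx
  obtain ⟨t₀, ht₀, -⟩ := hs.exists_element
  have hker : Module.finrank ℝ (LinearMap.ker (M.incidence o).transpose.mulVecLin) = 1 := by
    have hone : (fun _ : M.elements => (1 : ℝ)) ∈
        LinearMap.ker (M.incidence o).transpose.mulVecLin := by
      rw [LinearMap.mem_ker, Matrix.mulVecLin_apply]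
      ext e
      simp only [Matrix.mulVec, dotProduct, Matrix.transpose_apply, incidence, Matrix.of_apply,
        Pi.zero_apply]
      rw [Finset.sum_coe_sort M.elements (fun t => M.delta o t e * 1)]
      exact sum_delta_const o e.2 (1 : ℝ)
    refine finrank_eq_one ⟨_, hone⟩ ?_ ?_
    · intro h
      have := congrFun (congrArg Subtype.val h) ⟨t₀, ht₀⟩
      simp at this
    · rintro ⟨y, hy⟩
      rw [LinearMap.mem_ker, Matrix.mulVecLin_apply] at hy
      refine ⟨y ⟨t₀, ht₀⟩, Subtype.ext (funext fun t => ?_)⟩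
      let f : Finset V → ℝ := fun t => if h : t ∈ M.elements then y ⟨t, h⟩ else 0
      have hf : ∀ t : M.elements, f t = y t := fun t => by simp [f]
      have hjump : ∀ e ∈ M.internalEdges, ∀ t ∈ M.elements, ∀ t' ∈ M.elements, e ⊆ t → e ⊆ t' →
          f t = f t' := by
        intro e he t ht t' ht' h h'
        by_cases hne : t = t'
        · rw [hne]
        have h1 := congrFun hy ⟨e, he⟩
        simp only [Matrix.mulVec, dotProduct, Matrix.transpose_apply, incidence, Matrix.of_apply,
          Pi.zero_apply, ← hf] at h1
        rw [Finset.sum_coe_sort M.elements (fun t => M.delta o t e * f t)] at h1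
        have h2 := sum_delta_mul o he ht ht' hne h h' f
        simp only [smul_eq_mul] at h2
        rw [h2] at h1
        exact sub_eq_zero.1 ((mul_eq_zero.1 h1).resolve_left
          (delta_neighbor o he ht ht' hne h h').2)
      have := eq_of_jump_zero hconn f hjump ht₀ t.2
      simpa [← hf] using this
  have h1 := (M.incidence o).transpose.mulVecLin.finrank_range_add_finrank_ker
  rw [hker] at h1
  rw [← Matrix.rank_transpose]
  simpa [Matrix.rank] using h1

/-! ### Circuits -/

/-- The differences along the internal edges of a function on the vertexes. -/
def grad (g : V → ℝ) : M.internalEdges → ℝ := fun e => g (o.tail e) - g (o.head e)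

lemma sum_smul_rays (g : V → ℝ) : ∑ v, g v • M.rays o v = grad o g := by
  ext e
  simp [rays, grad, mul_sub, Finset.sum_sub_distrib]

lemma rays_eq_grad (v : V) : M.rays o v = grad o (fun u => if u = v then 1 else 0) := rfl

open Classical in
lemma holeLoop_eq_grad (C : Set (EuclideanSpace ℝ (Fin 2))) :
    M.holeLoop o C = grad o (fun u => if M.pos u ∈ C then 1 else 0) := by
  rw [← sum_smul_rays, holeLoop]
  exact Finset.sum_congr rfl fun v _ => by split_ifs <;> simp

/-- Functions on the vertexes that take the same value at the ends of every border edge. -/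
def BorderConst (M : PlanarMesh V) (g : V → ℝ) : Prop :=
  ∀ a b, a ≠ b → {a, b} ∈ M.edges → {a, b} ∉ M.internalEdges → g a = g b

/-- The contribution of an edge to the balance of an element. -/
def flux (t : Finset V) (g : V → ℝ) (e : Finset V) : ℝ :=
  if e ∈ M.internalEdges then M.delta o t e * (g (o.tail e) - g (o.head e)) else 0

variable {o} {g : V → ℝ}

lemma incidence_mul_grad (t : M.elements) (e : M.internalEdges) :
    M.incidence o t e * grad o g e = flux o t g e := by
  simp [incidence, grad, flux]

lemma IsCcw.flux_eq (h : M.IsCcw t a b c) (hg : M.BorderConst g) :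
    flux o t g {a, b} = g a - g b := by
  rw [flux]
  split_ifs with hi
  · rcases h.delta_cases o hi with ⟨h1, h2, h3⟩ | ⟨h1, h2, h3⟩ <;> rw [h1, h2, h3] <;> ring
  · rw [hg a b h.ab h.edge_mem hi, sub_self]

lemma flux_of_not_subset (h : ¬ e ⊆ t) : flux o t g e = 0 := by
  rw [flux, delta_of_not_subset o h]; simp

lemma IsCcw.edges_ne (h : M.IsCcw t a b c) : ({a, b} : Finset V) ≠ {b, c} := by
  intro h1
  have : a ∈ ({b, c} : Finset V) := by rw [← h1]; simp
  simp only [Finset.mem_insert, Finset.mem_singleton] at this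
  exact this.elim h.ab h.ac

lemma grad_mem_ker (hg : M.BorderConst g) :
    grad o g ∈ LinearMap.ker (M.incidence o).mulVecLin := by
  rw [LinearMap.mem_ker, Matrix.mulVecLin_apply]
  ext t
  obtain ⟨a, b, c, h⟩ := exists_isCcw t.2
  simp only [Matrix.mulVec, dotProduct, incidence_mul_grad, Pi.zero_apply]
  rw [Finset.sum_coe_sort M.internalEdges (fun e => flux o t g e)]
  have h1 : ∑ e ∈ M.internalEdges, flux o t g e =
      ∑ e ∈ ({{a, b}, {b, c}, {c, a}} : Finset (Finset V)), flux o t g e := by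
    refine Finset.sum_congr_of_eq_on_inter ?_ ?_ fun _ _ _ => rfl
    · intro e he he'
      refine flux_of_not_subset fun hsub => he' ?_
      simpa using h.edge_cases hsub (card_internalEdge he)
    · intro e _ he'
      rw [flux, if_neg he']
  have h2 : ({a, b} : Finset V) ≠ {c, a} := h.rotate.rotate.edges_ne.symm
  rw [h1, Finset.sum_insert (by simp [h.edges_ne, h2]), Finset.sum_pair h.rotate.edges_ne,
    h.flux_eq hg, h.rotate.flux_eq hg, h.rotate.rotate.flux_eq hg]
  ring

lemma IsCcw.circuit (h : M.IsCcw t a b c) (hg : M.BorderConst g) (hg01 : ∀ v, g v = 0 ∨ g v = 1)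
    (hac : g a = g c) (hab : g a ≠ g b) :
    ∃ e₁ e₂ : M.internalEdges, flux o t g e₁ = 1 ∧ flux o t g e₂ = -1 ∧
      ∀ e : M.internalEdges, e ≠ e₁ → e ≠ e₂ → flux o t g e = 0 := by
  have h1 : flux o t g {a, b} = g a - g b := h.flux_eq hg
  have h2 : flux o t g {b, c} = g b - g c := h.rotate.flux_eq hg
  have h3 : flux o t g {c, a} = g c - g a := h.rotate.rotate.flux_eq hg
  have hi1 : ({a, b} : Finset V) ∈ M.internalEdges := by
    by_contra hi
    exact hab (hg a b h.ab h.edge_mem hi)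
  have hi2 : ({b, c} : Finset V) ∈ M.internalEdges := by
    by_contra hi
    exact hab (hac.trans (hg b c h.bc h.rotate.edge_mem hi).symm)
  have hrest : ∀ e : M.internalEdges, e ≠ ⟨_, hi1⟩ → e ≠ ⟨_, hi2⟩ → flux o t g e = 0 := by
    intro e he1 he2
    by_cases hsub : (e : Finset V) ⊆ t
    · rcases h.edge_cases hsub (card_internalEdge e.2) with h' | h' | h'
      · exact (he1 (Subtype.ext h')).elim
      · exact (he2 (Subtype.ext h')).elim
      · rw [h', h3, hac, sub_self]
    · exact flux_of_not_subset hsub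
  rcases hg01 a with ha | ha <;> rcases hg01 b with hb | hb
  · exact (hab (ha.trans hb.symm)).elim
  · exact ⟨⟨_, hi2⟩, ⟨_, hi1⟩, by simp [h2, hb, ← hac, ha], by simp [h1, ha, hb],
      fun e he he' => hrest e he' he⟩
  · exact ⟨⟨_, hi1⟩, ⟨_, hi2⟩, by simp [h1, ha, hb], by simp [h2, hb, ← hac, ha], hrest⟩
  · exact (hab (ha.trans hb.symm)).elim

lemma isClosedCircuit_grad (hg : M.BorderConst g) (hg01 : ∀ v, g v = 0 ∨ g v = 1) :
    M.IsClosedCircuit o (grad o g) := by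
  refine ⟨fun e => ?_, fun t => ?_⟩
  · rw [grad]
    rcases hg01 (o.tail e) with h | h <;> rcases hg01 (o.head e) with h' | h' <;> simp [h, h']
  · simp only [incidence_mul_grad]
    obtain ⟨a, b, c, h⟩ := exists_isCcw t.2
    by_cases hab : g a = g b
    · by_cases hbc : g b = g c
      · left
        intro e
        by_cases hsub : (e : Finset V) ⊆ t
        · rcases h.edge_cases hsub (card_internalEdge e.2) with h' | h' | h' <;> rw [h']
          · rw [h.flux_eq hg, hab, sub_self]
          · rw [h.rotate.flux_eq hg, hbc, sub_self]
          · rw [h.rotate.rotate.flux_eq hg, hab, hbc, sub_self]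
        · exact flux_of_not_subset hsub
      · exact Or.inr (h.rotate.circuit hg hg01 hab.symm hbc)
    · by_cases hbc : g b = g c
      · exact Or.inr (h.rotate.rotate.circuit hg hg01 hbc.symm fun h => hab (h.symm.trans hbc.symm))
      · refine Or.inr (h.circuit hg hg01 ?_ hab)
        rcases hg01 a with h1 | h1 <;> rcases hg01 b with h2 | h2 <;>
          rcases hg01 c with h3 | h3 <;> simp_all

end


/-! ### The angle under which an arc is seen from a point -/

section Complex

open Complex

variable {p q z z₀ z₁ a b : ℂ}

lemma eq_neg_mul_of_div_notMem_slitPlane (h : p / q ∉ slitPlane) (hq : q ≠ 0) :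
    ∃ r : ℝ, 0 ≤ r ∧ p = -(r * q) := by
  rw [mem_slitPlane_iff, not_or, not_lt, not_not] at h
  refine ⟨-(p / q).re, by linarith [h.1], ?_⟩
  have : p / q = ((p / q).re : ℂ) := by
    apply Complex.ext <;> simp [h.2]
  rw [div_eq_iff hq] at this
  rw [ofReal_neg, neg_mul, neg_neg]
  exact this

lemma sub_div_sub_mem_slitPlane (h : p ∉ segment ℝ a b) : (a - p) / (b - p) ∈ slitPlane := by
  by_contra hn
  have hb : b - p ≠ 0 := fun hb => h (by
    rw [sub_eq_zero] at hb; rw [← hb]; exact right_mem_segment ℝ a b)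
  obtain ⟨r, hr, h1⟩ := eq_neg_mul_of_div_notMem_slitPlane hn hb
  have hr' : (1 : ℝ) + r ≠ 0 := by positivity
  refine h ⟨1 / (1 + r), r / (1 + r), by positivity, by positivity, by field_simp, ?_⟩
  have hr'' : (1 : ℂ) + r ≠ 0 := by exact_mod_cast hr'
  simp only [real_smul]
  push_cast
  field_simp
  linear_combination h1

lemma sub_div_sub_mem_slitPlane' (h : p ∉ segment ℝ a b) : (p - a) / (p - b) ∈ slitPlane := by
  rw [← neg_sub a p, ← neg_sub b p, neg_div_neg_eq]
  exact sub_div_sub_mem_slitPlane h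

lemma im_sub_div_sub : ((z - a) / (z - b)).im =
    -((b - a).re * (z - a).im - (b - a).im * (z - a).re) / normSq (z - b) := by
  rw [div_im]
  simp only [sub_re, sub_im]
  ring

lemma log_neg_eq_of_im_neg (h : z.im < 0) : log (-z) = log z + Real.pi * I := by
  apply Complex.ext
  · simp [log_re]
  · simp [log_im, arg_neg_eq_arg_add_pi_of_im_neg h]

lemma log_neg_eq_of_im_pos (h : 0 < z.im) : log (-z) = log z - Real.pi * I := by
  apply Complex.ext
  · simp [log_re]
  · simp [log_im, arg_neg_eq_arg_sub_pi_of_im_pos h]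

/-- The difference between the angles under which an arc is seen from two points. -/
lemma log_sub_log_eq {k : ℂ} (hk : k ≠ 0) (ha : a ∉ segment ℝ z₀ z₁) (hb : b ∉ segment ℝ z₀ z₁)
    (h : ∀ z ∈ segment ℝ z₀ z₁, k * ((z - a) / (z - b)) ∈ slitPlane) :
    log ((z₁ - a) / (z₀ - a)) - log ((z₁ - b) / (z₀ - b)) =
      log (k * ((z₁ - a) / (z₁ - b))) - log (k * ((z₀ - a) / (z₀ - b))) := by
  let γ : ℝ → ℂ := fun s => z₀ + s * (z₁ - z₀)
  have hγ : ∀ s, HasDerivAt γ (z₁ - z₀) s := fun s => by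
    exact (((hasDerivAt_id s).ofReal_comp.mul_const (z₁ - z₀)).const_add z₀).congr_deriv (by simp)
  have hmem : ∀ s ∈ Icc (0 : ℝ) 1, γ s ∈ segment ℝ z₀ z₁ := fun s hs => by
    rw [segment_eq_image']
    exact ⟨s, hs, by simp [γ]⟩
  have hslit : ∀ p ∉ segment ℝ z₀ z₁, ∀ s ∈ Icc (0 : ℝ) 1,
      γ s - p ≠ 0 ∧ z₀ - p ≠ 0 ∧ (γ s - p) / (z₀ - p) ∈ slitPlane := by
    intro p hp s hs
    refine ⟨fun h0 => hp ?_, fun h0 => hp ?_, sub_div_sub_mem_slitPlane fun hp' => hp ?_⟩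
    · rw [← sub_eq_zero.1 h0]; exact hmem s hs
    · rw [← sub_eq_zero.1 h0]; exact left_mem_segment ℝ _ _
    · exact (convex_segment z₀ z₁).segment_subset (hmem s hs) (left_mem_segment ℝ _ _) hp'
  let H : ℝ → ℂ := fun s => log ((γ s - a) / (z₀ - a)) - log ((γ s - b) / (z₀ - b)) -
    log (k * ((γ s - a) / (γ s - b)))
  have hH : ∀ s ∈ Icc (0 : ℝ) 1, HasDerivAt H 0 s := by
    intro s hs
    obtain ⟨a1, a2, a3⟩ := hslit a ha s hs
    obtain ⟨b1, b2, b3⟩ := hslit b hb s hs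
    have h1 := (((hγ s).sub_const a).div_const (z₀ - a)).clog_real a3
    have h2 := (((hγ s).sub_const b).div_const (z₀ - b)).clog_real b3
    have h3 := ((((hγ s).sub_const a).fun_div ((hγ s).sub_const b) b1).const_mul k).clog_real
      (h _ (hmem s hs))
    refine ((h1.sub h2).sub h3).congr_deriv ?_
    field_simp
    ring
  have hc := constant_of_has_deriv_right_zero (f := H) (a := 0) (b := 1)
    (fun s hs => (hH s hs).continuousAt.continuousWithinAt)
    (fun s hs => (hH s (Ico_subset_Icc_self hs)).hasDerivWithinAt) 1 (right_mem_Icc.2 zero_le_one)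
  obtain ⟨-, a2, -⟩ := hslit a ha 0 (left_mem_Icc.2 zero_le_one)
  obtain ⟨-, b2, -⟩ := hslit b hb 0 (left_mem_Icc.2 zero_le_one)
  simp only [H, γ, ofReal_zero, zero_mul, add_zero, ofReal_one, one_mul, add_sub_cancel,
    div_self a2, div_self b2, log_one, sub_zero] at hc
  linear_combination hc

lemma log_sub_log_of_disjoint (h : Disjoint (segment ℝ a b) (segment ℝ z₀ z₁)) :
    log ((z₁ - a) / (z₀ - a)) - log ((z₁ - b) / (z₀ - b)) =
      log ((z₁ - a) / (z₁ - b)) - log ((z₀ - a) / (z₀ - b)) := by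
  have := log_sub_log_eq (k := 1) one_ne_zero
    (Set.disjoint_left.1 h (left_mem_segment ℝ _ _)) (Set.disjoint_left.1 h (right_mem_segment ℝ _ _))
    (fun z hz => by
      rw [one_mul]
      exact sub_div_sub_mem_slitPlane' (Set.disjoint_right.1 h hz))
  simpa using this

/-- The same difference, for an arc that goes to the midpoint of the segment between the points. -/
lemma log_sub_log_of_midpoint (hab : a ≠ b) (hne : ((z₀ - a) / (z₀ - b)).im ≠ 0)
    (ha : a ∉ segment ℝ z₀ ((1 / 2 : ℝ) • (a + b))) (hb : b ∉ segment ℝ z₀ ((1 / 2 : ℝ) • (a + b))) :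
    log (((1 / 2 : ℝ) • (a + b) - a) / (z₀ - a)) - log (((1 / 2 : ℝ) • (a + b) - b) / (z₀ - b)) =
      -log (-((z₀ - a) / (z₀ - b))) := by
  have hmid : -1 * (((1 / 2 : ℝ) • (a + b) - a) / ((1 / 2 : ℝ) • (a + b) - b)) = 1 := by
    have h1 : (1 / 2 : ℝ) • (a + b) - b ≠ 0 := by
      rw [real_smul]
      intro h0
      apply hab
      push_cast at h0
      linear_combination 2 * h0
    rw [← mul_div_assoc, div_eq_one_iff_eq h1, real_smul]
    push_cast
    ring
  have := log_sub_log_eq (k := -1) (by norm_num) ha hb ?_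
  · rw [this, hmid, log_one, zero_sub, neg_one_mul]
  · intro z hz
    rw [segment_symm, segment_eq_image'] at hz
    obtain ⟨θ, hθ, rfl⟩ := hz
    rcases hθ.1.eq_or_lt with rfl | hθ0
    · beta_reduce
      rw [zero_smul, add_zero, hmid]
      exact one_mem_slitPlane
    · beta_reduce
      rw [neg_one_mul, mem_slitPlane_iff]
      right
      rw [neg_im, neg_ne_zero, im_sub_div_sub]
      rw [im_sub_div_sub] at hne
      have hzb : (1 / 2 : ℝ) • (a + b) + θ • (z₀ - (1 / 2 : ℝ) • (a + b)) - b ≠ 0 := by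
        intro h0
        apply hb
        rw [segment_symm, segment_eq_image']
        exact ⟨θ, hθ, sub_eq_zero.1 h0⟩
      refine div_ne_zero ?_ (normSq_pos.2 hzb).ne'
      rw [neg_ne_zero]
      rw [div_ne_zero_iff, neg_ne_zero] at hne
      have : (b - a).re * ((1 / 2 : ℝ) • (a + b) + θ • (z₀ - (1 / 2 : ℝ) • (a + b)) - a).im -
          (b - a).im * ((1 / 2 : ℝ) • (a + b) + θ • (z₀ - (1 / 2 : ℝ) • (a + b)) - a).re =
          θ * ((b - a).re * (z₀ - a).im - (b - a).im * (z₀ - a).re) := by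
        simp only [sub_re, sub_im, add_re, add_im, smul_re, smul_im, smul_eq_mul]
        ring
      rw [this]
      exact mul_ne_zero hθ0.ne' hne.1

lemma hasDerivAt_log_div (h : p ∉ segment ℝ z₀ z₁) :
    HasDerivAt (fun p => log ((z₁ - p) / (z₀ - p))) (1 / (z₀ - p) - 1 / (z₁ - p)) p := by
  have h0 : z₀ - p ≠ 0 := fun h0 => h (by
    rw [← sub_eq_zero.1 h0]; exact left_mem_segment ℝ _ _)
  have h1 : z₁ - p ≠ 0 := fun h0 => h (by
    rw [← sub_eq_zero.1 h0]; exact right_mem_segment ℝ _ _)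
  have hs : (z₁ - p) / (z₀ - p) ∈ slitPlane :=
    sub_div_sub_mem_slitPlane (by rwa [segment_symm])
  have := (((hasDerivAt_id p).const_sub z₁).fun_div ((hasDerivAt_id p).const_sub z₀) h0).clog hs
  refine this.congr_deriv ?_
  simp only [id]
  field_simp
  ring

lemma tendsto_log_div (z₀ z₁ : ℂ) :
    Tendsto (fun p => log ((z₁ - p) / (z₀ - p))) (Bornology.cobounded ℂ) (𝓝 0) := by
  have h1 : Tendsto (fun p : ℂ => z₀ - p) (Bornology.cobounded ℂ) (Bornology.cobounded ℂ) :=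
    tendsto_const_sub_cobounded z₀
  have h2 : Tendsto (fun p : ℂ => 1 + (z₁ - z₀) * (z₀ - p)⁻¹) (Bornology.cobounded ℂ) (𝓝 1) := by
    simpa using ((tendsto_inv₀_cobounded.comp h1).const_mul (z₁ - z₀)).const_add 1
  have h3 : Tendsto (fun p : ℂ => (z₁ - p) / (z₀ - p)) (Bornology.cobounded ℂ) (𝓝 1) := by
    refine h2.congr' ?_
    filter_upwards [h1.eventually_ne_cobounded 0] with p hp
    field_simp
    ring
  have := (continuousAt_clog one_mem_slitPlane).tendsto.comp h3
  rwa [log_one] at this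

/-- A function with zero derivative on an open set is constant on its preconnected subsets. -/
lemma eq_of_deriv_zero {U S : Set ℂ} {f : ℂ → ℂ} (hU : IsOpen U)
    (hf : ∀ z ∈ U, HasDerivAt f 0 z) (hS : IsPreconnected S) (hSU : S ⊆ U) (hp : p ∈ S)
    (hq : q ∈ S) : f p = f q := by
  have hopen := fun T => hU.isOpen_inter_preimage_of_deriv_eq_zero
    (fun z hz => (hf z hz).differentiableAt.differentiableWithinAt) (fun z hz => (hf z hz).deriv) T
  by_contra hne
  obtain ⟨z, -, ⟨-, h1⟩, -, h2⟩ := hS _ _ (hopen {f p}) (hopen {f p}ᶜ)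
    (fun z hz => by
      by_cases h : f z = f p
      · exact Or.inl ⟨hSU hz, h⟩
      · exact Or.inr ⟨hSU hz, h⟩)
    ⟨p, hp, hSU hp, rfl⟩ ⟨q, hq, hSU hq, fun h => hne h.symm⟩
  exact h2 h1

end Complex

section

variable {V : Type*} [Fintype V] [DecidableEq V] {M : PlanarMesh V}
  {t t' s s' r e : Finset V} {x y : EuclideanSpace ℝ (Fin 2)} {u v a b c : V}

/-! ### Winding numbers of a circuit -/

/-- The identification of the plane with the complex numbers. -/
def toComplex : EuclideanSpace ℝ (Fin 2) ≃ₗᵢ[ℝ] ℂ := Complex.orthonormalBasisOneI.repr.symm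

lemma toComplex_re (x) : (toComplex x).re = x 0 := by simp [toComplex]

lemma toComplex_im (x) : (toComplex x).im = x 1 := by simp [toComplex]

lemma toComplex_segment (x y) : segment ℝ (toComplex x) (toComplex y) =
    toComplex '' segment ℝ x y :=
  (image_segment ℝ toComplex.toLinearEquiv.toLinearMap.toAffineMap x y).symm

/-- The center of an element. -/
def center (M : PlanarMesh V) (t : Finset V) : EuclideanSpace ℝ (Fin 2) :=
  ∑ v ∈ t, (1 / 3 : ℝ) • M.pos v

/-- The midpoint of an edge. -/
def midpt (M : PlanarMesh V) (e : Finset V) : EuclideanSpace ℝ (Fin 2) :=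
  ∑ v ∈ e, (1 / 2 : ℝ) • M.pos v

lemma center_mem (ht : t ∈ M.elements) : M.center t ∈ M.openCell t :=
  ⟨fun _ => 1 / 3, fun _ _ => by norm_num, by simp [M.card_eq_three t ht], rfl⟩

lemma midpt_mem (he : e ∈ M.internalEdges) : M.midpt e ∈ M.openCell e :=
  ⟨fun _ => 1 / 2, fun _ _ => by norm_num, by simp [card_internalEdge he], rfl⟩

/-- The arc from the center of an element to the midpoint of an internal edge is contained in
these two cells. -/
lemma mem_arc (ht : t ∈ M.elements) (he : e ∈ M.internalEdges) (h : e ⊆ t)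
    (hx : x ∈ segment ℝ (M.center t) (M.midpt e)) : ∃ s, (s = t ∨ s = e) ∧ x ∈ M.openCell s := by
  have h1 := center_mem ht
  have h2 := midpt_mem he
  rw [mem_openCell_element ht] at h1
  have h2' := (mem_openCell_iff ht h).1 h2
  rw [segment_eq_image_lineMap] at hx
  obtain ⟨θ, hθ, rfl⟩ := hx
  rcases hθ.2.eq_or_lt with rfl | hlt
  · exact ⟨e, Or.inr rfl, by rwa [AffineMap.lineMap_apply_one]⟩
  · refine ⟨t, Or.inl rfl, ?_⟩
    rw [mem_openCell_element ht]
    intro v hv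
    rw [AffineMap.apply_lineMap, AffineMap.lineMap_apply_ring]
    have h3 : 0 ≤ M.bary t v (M.midpt e) := by
      by_cases hve : v ∈ e
      · exact (h2'.1 v hve).le
      · exact (h2'.2 v hv hve).ge
    have h4 := mul_pos (sub_pos.2 hlt) (h1 v hv)
    have h5 := mul_nonneg hθ.1 h3
    linarith

lemma mem_arc_internal (ht : t ∈ M.elements) (he : e ∈ M.internalEdges) (h : e ⊆ t)
    (hx : x ∈ segment ℝ (M.center t) (M.midpt e)) :
    ∃ s, (s = t ∨ s = e) ∧ M.IsInternal s ∧ x ∈ M.openCell s := by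
  obtain ⟨s, hs, hx⟩ := mem_arc ht he h hx
  refine ⟨s, hs, ?_, hx⟩
  rcases hs with rfl | rfl
  · exact Or.inl ht
  · exact Or.inr (Or.inl he)

lemma arc_subset_domain (ht : t ∈ M.elements) (he : e ∈ M.internalEdges) (h : e ⊆ t) :
    segment ℝ (M.center t) (M.midpt e) ⊆ M.domain := by
  intro x hx
  obtain ⟨s, -, hs, hx⟩ := mem_arc_internal ht he h hx
  exact mem_domain.2 ⟨s, hs, hx⟩

lemma pos_notMem_arc (ht : t ∈ M.elements) (he : e ∈ M.internalEdges) (h : e ⊆ t) (v : V) :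
    M.pos v ∉ segment ℝ (M.center t) (M.midpt e) := by
  intro hx
  obtain ⟨s, hs, hsi, hx⟩ := mem_arc_internal ht he h hx
  obtain ⟨t', ht', hv⟩ := M.exists_element v
  have h1 := internal_unique hsi hx ht' (s' := {v}) (by simpa using hv) (by simp)
  rcases hs with rfl | rfl
  · have := M.card_eq_three _ ht
    simp [h1] at this
  · have := card_internalEdge he
    simp [h1] at this

lemma disjoint_arc (ht : t ∈ M.elements) (he : e ∈ M.internalEdges) (h : e ⊆ t)
    (hab : a ≠ b) (hi : {a, b} ∈ M.internalEdges) (hne : e ≠ {a, b}) :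
    Disjoint (segment ℝ (M.pos a) (M.pos b)) (segment ℝ (M.center t) (M.midpt e)) := by
  rw [Set.disjoint_left]
  intro x hx hx'
  rw [← insert_endpoints_openSegment] at hx
  rcases hx with rfl | rfl | ⟨p, q, hp, hq, hpq, rfl⟩
  · exact pos_notMem_arc ht he h _ hx'
  · exact pos_notMem_arc ht he h _ hx'
  · obtain ⟨s, hs, hsi, hx⟩ := mem_arc_internal ht he h hx'
    obtain ⟨t', ht', h', -⟩ := mem_edges.1 (mem_edges_of_internal hi)
    have h1 := internal_unique hsi hx ht' h'
      ⟨fun v => if v = a then p else q, fun v _ => by dsimp only; split_ifs <;> assumption,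
        by simp [Finset.sum_pair hab, hab.symm, hpq], by simp [Finset.sum_pair hab, hab.symm]⟩
    rcases hs with rfl | rfl
    · have h2 := M.card_eq_three _ ht
      rw [h1, Finset.card_pair hab] at h2
      norm_num at h2
    · exact hne h1

variable (o : M.EdgeOrientation) (w : Finset V → ℝ)

/-- The balance of all elements. -/
def Balanced : Prop := ∀ t ∈ M.elements, ∑ e ∈ M.internalEdges, M.delta o t e * w e = 0

/-- The total angle, up to the factor `I`, under which a circuit is seen from a point. -/
def winding (p : ℂ) : ℂ := ∑ t ∈ M.elements, ∑ e ∈ M.internalEdges, (M.delta o t e * w e) •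
  Complex.log ((toComplex (M.midpt e) - p) / (toComplex (M.center t) - p))

variable {o w}

lemma sum_balanced (hw : Balanced o w) (B C : Finset V → ℂ) :
    ∑ t ∈ M.elements, ∑ e ∈ M.internalEdges, (M.delta o t e * w e) • (C e - B t) = 0 := by
  simp only [smul_sub, Finset.sum_sub_distrib]
  have h1 : ∑ t ∈ M.elements, ∑ e ∈ M.internalEdges, (M.delta o t e * w e) • B t = 0 := by
    refine Finset.sum_eq_zero fun t ht => ?_
    rw [← Finset.sum_smul, hw t ht, zero_smul]
  have h2 : ∑ t ∈ M.elements, ∑ e ∈ M.internalEdges, (M.delta o t e * w e) • C e = 0 := by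
    rw [Finset.sum_comm]
    refine Finset.sum_eq_zero fun e he => ?_
    simp only [mul_smul]
    exact sum_delta_const o he (w e • C e)
  rw [h1, h2, sub_zero]

lemma hasDerivAt_winding (hw : Balanced o w) {z : ℂ}
    (hz : ∀ t ∈ M.elements, ∀ e ∈ M.internalEdges, e ⊆ t →
      z ∉ segment ℝ (toComplex (M.center t)) (toComplex (M.midpt e))) :
    HasDerivAt (winding o w) 0 z := by
  have h0 := sum_balanced hw (fun t => -(1 / (toComplex (M.center t) - z)))
    (fun e => -(1 / (toComplex (M.midpt e) - z)))
  rw [← h0]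
  unfold winding
  refine HasDerivAt.fun_sum fun t ht => HasDerivAt.fun_sum fun e he => ?_
  by_cases h : e ⊆ t
  · have := (hasDerivAt_log_div (hz t ht e he h)).const_smul (M.delta o t e * w e)
    refine this.congr_deriv ?_
    congr 1
    ring
  · simp only [delta_of_not_subset o h, zero_mul, zero_smul]
    exact hasDerivAt_const _ _

lemma winding_eq (hw : Balanced o w) {S : Set (EuclideanSpace ℝ (Fin 2))} (hS : IsPreconnected S)
    (hSD : S ⊆ M.domainᶜ) (hx : x ∈ S) (hy : y ∈ S) :
    winding o w (toComplex x) = winding o w (toComplex y) := by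
  let A : Set ℂ := ⋃ p ∈ {p : Finset V × Finset V | p.1 ∈ M.elements ∧ p.2 ∈ M.internalEdges ∧
    p.2 ⊆ p.1}, segment ℝ (toComplex (M.center p.1)) (toComplex (M.midpt p.2))
  have hA : IsClosed A := (Set.toFinite _).isClosed_biUnion fun p _ => by
    rw [segment_eq_image_lineMap]
    exact (isCompact_Icc.image AffineMap.lineMap_continuous).isClosed
  have hnot : ∀ z ∈ Aᶜ, ∀ t ∈ M.elements, ∀ e ∈ M.internalEdges, e ⊆ t →
      z ∉ segment ℝ (toComplex (M.center t)) (toComplex (M.midpt e)) :=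
    fun z hz t ht e he h hmem => hz (mem_biUnion (x := (t, e)) ⟨ht, he, h⟩ hmem)
  refine eq_of_deriv_zero hA.isOpen_compl (fun z hz => hasDerivAt_winding hw (hnot z hz))
    (hS.image _ toComplex.continuous.continuousOn) ?_ (mem_image_of_mem _ hx)
    (mem_image_of_mem _ hy)
  rintro _ ⟨z, hz, rfl⟩ hzA
  simp only [A, mem_iUnion] at hzA
  obtain ⟨⟨t, e⟩, ⟨ht, he, h⟩, hmem⟩ := hzA
  rw [toComplex_segment, toComplex.injective.mem_set_image] at hmem
  exact hSD hz (arc_subset_domain ht he h hmem)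

lemma tendsto_winding : Tendsto (winding o w) (Bornology.cobounded ℂ) (𝓝 0) := by
  have : Tendsto (winding o w) (Bornology.cobounded ℂ)
      (𝓝 (∑ t ∈ M.elements, ∑ e ∈ M.internalEdges, (M.delta o t e * w e) • (0 : ℂ))) :=
    tendsto_finsetSum _ fun t _ => tendsto_finsetSum _ fun e _ =>
      (tendsto_log_div _ _).const_smul _
  simpa using this

lemma winding_eq_zero (hw : Balanced o w) {S : Set (EuclideanSpace ℝ (Fin 2))}
    (hS : IsPreconnected S) (hSD : S ⊆ M.domainᶜ) (hb : ¬ Bornology.IsBounded S) (hx : x ∈ S) :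
    winding o w (toComplex x) = 0 := by
  by_contra hne
  have h1 := (tendsto_winding (o := o) (w := w)).eventually_ne (Ne.symm hne)
  rw [Filter.eventually_iff] at h1
  replace h1 := Bornology.isBounded_compl_iff.2 h1
  apply hb
  have h2 : Bornology.IsBounded (toComplex '' S) := by
    refine h1.subset ?_
    rintro _ ⟨y, hy, rfl⟩ h
    exact h (winding_eq hw hS hSD hy hx)
  have h3 := toComplex.symm.lipschitz.isBounded_image h2
  simpa [Set.image_image] using h3

lemma delta_eq_sign_center {t : Finset V} (ht : t ∈ M.elements) {c : V} (h : t = {a, b, c})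
    (hab : a ≠ b) (hac : a ≠ c) (hbc : b ≠ c) (htail : o.tail {a, b} = a)
    (hhead : o.head {a, b} = b) :
    M.delta o t {a, b} =
      Real.sign (cross (M.pos b - M.pos a) (M.center t - M.pos a)) := by
  rw [delta_eq o h hac hbc, htail, hhead, cross_eq_bary_mul ht h hab hac hbc (M.center t)]
  have hpos := (mem_openCell_element ht).1 (center_mem ht) c (by simp [h])
  rcases (cross_ne_zero ht h hab hac hbc).lt_or_gt with h0 | h0
  · rw [Real.sign_of_neg h0, Real.sign_of_neg (mul_neg_of_pos_of_neg hpos h0)]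
  · rw [Real.sign_of_pos h0, Real.sign_of_pos (mul_pos hpos h0)]

lemma log_sub_log_across (ht : t ∈ M.elements) (hi : {a, b} ∈ M.internalEdges) (h : {a, b} ⊆ t)
    (hab : a ≠ b) (htail : o.tail {a, b} = a) (hhead : o.head {a, b} = b) :
    M.delta o t {a, b} * M.delta o t {a, b} = 1 ∧
    Complex.log ((toComplex (M.midpt {a, b}) - toComplex (M.pos a)) /
      (toComplex (M.center t) - toComplex (M.pos a))) -
    Complex.log ((toComplex (M.midpt {a, b}) - toComplex (M.pos b)) /
      (toComplex (M.center t) - toComplex (M.pos b))) =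
    -Complex.log ((toComplex (M.center t) - toComplex (M.pos a)) /
      (toComplex (M.center t) - toComplex (M.pos b))) -
      M.delta o t {a, b} • (Real.pi * Complex.I) := by
  obtain ⟨c, hc, hac, hbc⟩ := exists_third ht hab h
  have hposab : ∀ v, toComplex (M.pos v) ∉
      segment ℝ (toComplex (M.center t)) (toComplex (M.midpt {a, b})) := fun v hv => by
    rw [toComplex_segment, toComplex.injective.mem_set_image] at hv
    exact pos_notMem_arc ht hi h v hv
  have hmid : toComplex (M.midpt {a, b}) =
      (1 / 2 : ℝ) • (toComplex (M.pos a) + toComplex (M.pos b)) := by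
    rw [midpt, Finset.sum_pair hab, ← smul_add, map_smul, map_add]
  have hne : toComplex (M.pos a) ≠ toComplex (M.pos b) := fun h0 => by
    have h1 := bary_ne ht (u := a) (v := b) (by simp [hc]) (by simp [hc]) hab.symm
    rw [toComplex.injective h0, bary_self ht (by simp [hc])] at h1
    exact one_ne_zero h1
  have hcb : toComplex (M.center t) - toComplex (M.pos b) ≠ 0 := fun h0 => by
    apply hposab b
    rw [← sub_eq_zero.1 h0]
    exact left_mem_segment ℝ _ _
  have him : ((toComplex (M.center t) - toComplex (M.pos a)) /
      (toComplex (M.center t) - toComplex (M.pos b))).im =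
      -cross (M.pos b - M.pos a) (M.center t - M.pos a) /
        Complex.normSq (toComplex (M.center t) - toComplex (M.pos b)) := by
    rw [im_sub_div_sub]
    simp only [← map_sub, toComplex_re, toComplex_im, cross]
  have hn := Complex.normSq_pos.2 hcb
  have hcr : cross (M.pos b - M.pos a) (M.center t - M.pos a) ≠ 0 := by
    rw [cross_eq_bary_mul ht hc hab hac hbc (M.center t)]
    exact mul_ne_zero ((mem_openCell_element ht).1 (center_mem ht) c (by simp [hc])).ne'
      (cross_ne_zero ht hc hab hac hbc)
  have hpa := hposab a
  have hpb := hposab b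
  rw [hmid] at hpa hpb
  rw [hmid, log_sub_log_of_midpoint hne ?_ hpa hpb,
    delta_eq_sign_center ht hc hab hac hbc htail hhead]
  · rcases hcr.lt_or_gt with h0 | h0
    · rw [Real.sign_of_neg h0, log_neg_eq_of_im_pos]
      · refine ⟨by norm_num, ?_⟩
        simp
        ring
      · rw [him]
        exact div_pos (by linarith) hn
    · rw [Real.sign_of_pos h0, log_neg_eq_of_im_neg]
      · refine ⟨by norm_num, ?_⟩
        simp
        ring
      · rw [him]
        exact div_neg_of_neg_of_pos (by linarith) hn
  · rw [him]
    exact div_ne_zero (neg_ne_zero.2 hcr) hn.ne'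

/-- The jump of the winding number along an internal edge. -/
lemma winding_sub_winding (hw : Balanced o w) (he : e ∈ M.internalEdges) :
    winding o w (toComplex (M.pos (o.tail e))) - winding o w (toComplex (M.pos (o.head e))) =
      -(2 * w e) • (Real.pi * Complex.I) := by
  obtain ⟨a, b, hab, hta, hhb, rfl⟩ : ∃ a b, a ≠ b ∧ o.tail e = a ∧ o.head e = b ∧ e = {a, b} :=
    ⟨_, _, tail_ne_head o he, rfl, rfl, o.ends e he⟩
  rw [hta, hhb]
  let L : EuclideanSpace ℝ (Fin 2) → ℂ := fun x =>
    Complex.log ((toComplex x - toComplex (M.pos a)) / (toComplex x - toComplex (M.pos b)))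
  let C : Finset V → ℂ := fun f => if f = {a, b} then 0 else L (M.midpt f)
  have hterm : ∀ t ∈ M.elements, ∀ f ∈ M.internalEdges,
      (M.delta o t f * w f) • Complex.log ((toComplex (M.midpt f) - toComplex (M.pos a)) /
        (toComplex (M.center t) - toComplex (M.pos a))) -
      (M.delta o t f * w f) • Complex.log ((toComplex (M.midpt f) - toComplex (M.pos b)) /
        (toComplex (M.center t) - toComplex (M.pos b))) =
      (M.delta o t f * w f) • (C f - L (M.center t)) -
        (if f = {a, b} then
          (M.delta o t {a, b} * M.delta o t {a, b}) • (w {a, b} • (Real.pi * Complex.I))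
        else 0) := by
    intro t ht f hf
    by_cases hsub : f ⊆ t
    · rw [← smul_sub]
      by_cases hfe : f = {a, b}
      · subst hfe
        rw [(log_sub_log_across ht hf hsub hab hta hhb).2, if_pos rfl]
        simp only [C, L, if_true, smul_sub, ← mul_smul]
        rw [smul_zero, zero_sub, smul_neg]
        ring_nf
      · rw [if_neg hfe, sub_zero, log_sub_log_of_disjoint]
        · simp [C, L, hfe]
        · rw [toComplex_segment, toComplex_segment,
            Set.disjoint_image_iff toComplex.injective]
          exact disjoint_arc ht hf hsub hab he hfe
    · by_cases hfe : f = {a, b}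
      · subst hfe
        simp [delta_of_not_subset o hsub]
      · simp [delta_of_not_subset o hsub, hfe]
  obtain ⟨t, ht, h, _⟩ := mem_edges.1 (mem_edges_of_internal he)
  obtain ⟨t', ht', hne, h', -⟩ := exists_neighbor he ht h
  have hsum : ∑ t ∈ M.elements, ∑ f ∈ M.internalEdges, (if f = {a, b} then
      (M.delta o t {a, b} * M.delta o t {a, b}) • (w {a, b} • (Real.pi * Complex.I) : ℂ) else 0) =
      (2 * w {a, b}) • (Real.pi * Complex.I) := by
    simp only [Finset.sum_ite_eq', he, if_true]
    rw [← Finset.sum_smul]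
    have h1 := sum_delta_mul o he ht ht' hne h h' (fun t => M.delta o t {a, b})
    simp only [smul_eq_mul] at h1
    rw [h1, (delta_neighbor o he ht ht' hne h h').1, sub_neg_eq_add, mul_add,
      (log_sub_log_across ht he h hab hta hhb).1, ← mul_smul]
    norm_num
  rw [winding, winding, ← Finset.sum_sub_distrib]
  simp only [← Finset.sum_sub_distrib]
  rw [Finset.sum_congr rfl fun t ht => Finset.sum_congr rfl (hterm t ht)]
  simp only [Finset.sum_sub_distrib]
  rw [hsum, sum_balanced hw (fun t => L (M.center t)) C, zero_sub, neg_smul]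

lemma exists_potential (w : M.internalEdges → ℝ)
    (hw : w ∈ LinearMap.ker (M.incidence o).mulVecLin) :
    ∃ F : V → ℝ, grad o F = w ∧
      (∀ u v, M.pos v ∉ M.domain → M.pos u ∈ connectedComponentIn M.domainᶜ (M.pos v) →
        F u = F v) ∧
      ∀ v, M.pos v ∉ M.domain →
        ¬ Bornology.IsBounded (connectedComponentIn M.domainᶜ (M.pos v)) → F v = 0 := by
  let w' : Finset V → ℝ := fun e => if h : e ∈ M.internalEdges then w ⟨e, h⟩ else 0
  have hw' : ∀ e : M.internalEdges, w' e = w e := fun e => by simp [w']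
  have hbal : Balanced o w' := by
    intro t ht
    rw [LinearMap.mem_ker, Matrix.mulVecLin_apply] at hw
    have h1 := congrFun hw ⟨t, ht⟩
    simp only [Matrix.mulVec, dotProduct, incidence, Matrix.of_apply, Pi.zero_apply, ← hw'] at h1
    rwa [Finset.sum_coe_sort M.internalEdges (fun e => M.delta o t e * w' e)] at h1
  refine ⟨fun v => -(winding o w' (toComplex (M.pos v))).im / (2 * Real.pi), ?_, ?_, ?_⟩
  · ext e
    have h1 := congrArg Complex.im (winding_sub_winding hbal e.2)
    simp only [Complex.sub_im, Complex.smul_im, Complex.im_ofReal_mul, Complex.I_im, mul_one,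
      smul_eq_mul, hw'] at h1
    rw [grad, ← sub_div, div_eq_iff (by positivity)]
    linarith
  · intro u v hv hu
    dsimp only
    rw [winding_eq hbal isPreconnected_connectedComponentIn (connectedComponentIn_subset _ _) hu
      (mem_connectedComponentIn hv)]
  · intro v hv hb
    dsimp only
    rw [winding_eq_zero hbal isPreconnected_connectedComponentIn (connectedComponentIn_subset _ _)
      hb (mem_connectedComponentIn hv)]
    simp

end


section

variable {V : Type*} [Fintype V] [DecidableEq V] {M : PlanarMesh V}
  {t t' s s' r e : Finset V} {x y : EuclideanSpace ℝ (Fin 2)} {u v a b c : V}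

/-! ### Vertexes on the components of the complement -/

lemma domain_subset_closed : M.domain ⊆ ⋃ t ∈ M.elements, ⋂ v ∈ t, {y | 0 ≤ M.bary t v y} := by
  intro x hx
  obtain ⟨s, hs, hx⟩ := mem_domain.1 hx
  obtain ⟨t, ht, hst⟩ := hs.exists_element
  rw [mem_openCell_iff ht hst] at hx
  simp only [mem_iUnion, mem_iInter]
  refine ⟨t, ht, fun v hv => ?_⟩
  by_cases hvs : v ∈ s
  · exact (hx.1 v hvs).le
  · exact (hx.2 v hv hvs).ge

/-- The points of the closure of the domain lie on some face. -/
lemma exists_face_of_mem_closure (hx : x ∈ closure M.domain) :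
    ∃ t ∈ M.elements, ∃ r ⊆ t, x ∈ M.openCell r := by
  have hcl : IsClosed (⋃ t ∈ M.elements, ⋂ v ∈ t, {y | 0 ≤ M.bary t v y}) :=
    isClosed_biUnion_finset fun t _ => isClosed_biInter fun v _ =>
      isClosed_le continuous_const (by fun_prop)
  have h1 := closure_minimal domain_subset_closed hcl hx
  simp only [mem_iUnion, mem_iInter] at h1
  obtain ⟨t, ht, h⟩ := h1
  refine ⟨t, ht, t.filter (fun v => 0 < M.bary t v x), Finset.filter_subset _ _, ?_⟩
  rw [mem_openCell_iff ht (Finset.filter_subset _ _)]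
  refine ⟨fun v hv => (Finset.mem_filter.1 hv).2, fun v hv hv' => ?_⟩
  rw [Finset.mem_filter, not_and] at hv'
  exact le_antisymm (not_lt.1 (hv' hv)) (h v hv)

lemma exists_closure_mem (hx : x ∉ M.domain)
    (hb : Bornology.IsBounded (connectedComponentIn M.domainᶜ x)) :
    ∃ y ∈ connectedComponentIn M.domainᶜ x, y ∈ closure M.domain := by
  by_contra! hn
  have hxC := mem_connectedComponentIn (F := M.domainᶜ) hx
  have hclosed : IsClosed (connectedComponentIn M.domainᶜ x) := by
    refine isClosed_of_closure_subset ?_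
    refine isPreconnected_connectedComponentIn.closure.subset_connectedComponentIn
      (subset_closure hxC) ?_
    exact closure_minimal (connectedComponentIn_subset _ _) isOpen_domain.isClosed_compl
  have hopen : IsOpen (connectedComponentIn M.domainᶜ x) := by
    rw [Metric.isOpen_iff]
    intro y hy
    obtain ⟨ε, hε, hball⟩ := Metric.isOpen_iff.1 isClosed_closure.isOpen_compl y (hn y hy)
    refine ⟨ε, hε, ?_⟩
    rw [connectedComponentIn_eq hy]
    exact (convex_ball y ε).isPreconnected.subset_connectedComponentIn (Metric.mem_ball_self hε)
      (hball.trans (compl_subset_compl.2 subset_closure))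
  have := IsClopen.eq_univ ⟨hclosed, hopen⟩ ⟨x, hxC⟩
  rw [this] at hb
  exact NormedSpace.unbounded_univ ℝ _ hb

lemma openCell_pair_subset (hab : a ≠ b) :
    M.openCell {a, b} ⊆ segment ℝ (M.pos a) (M.pos b) := by
  rintro _ ⟨w, hw, hw1, rfl⟩
  rw [Finset.sum_pair hab] at hw1 ⊢
  exact ⟨w a, w b, (hw a (by simp)).le, (hw b (by simp)).le, hw1, rfl⟩

lemma exists_vertex_mem (hx : x ∉ M.domain)
    (hb : Bornology.IsBounded (connectedComponentIn M.domainᶜ x)) :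
    ∃ v, M.pos v ∈ connectedComponentIn M.domainᶜ x := by
  obtain ⟨y, hy, hcl⟩ := exists_closure_mem hx hb
  obtain ⟨t, ht, r, hr, hyr⟩ := exists_face_of_mem_closure hcl
  have hyD := connectedComponentIn_subset _ _ hy
  have hri : ¬ M.IsInternal r := fun h => hyD (mem_domain.2 ⟨r, h, hyr⟩)
  have hr3 := Finset.card_le_card hr
  rw [M.card_eq_three t ht] at hr3
  have h0 : r.card ≠ 0 := by
    intro h0
    obtain rfl := Finset.card_eq_zero.1 h0
    obtain ⟨w, -, h, -⟩ := hyr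
    simp at h
  by_cases h1 : r.card = 1
  · obtain ⟨v, rfl⟩ := Finset.card_eq_one.1 h1
    rw [openCell_singleton] at hyr
    exact ⟨v, by rwa [← mem_singleton_iff.1 hyr]⟩
  by_cases h2 : r.card = 2
  · obtain ⟨a, b, hab, rfl⟩ := Finset.card_eq_two.1 h2
    refine ⟨a, ?_⟩
    rw [connectedComponentIn_eq hy]
    exact (convex_segment _ _).isPreconnected.subset_connectedComponentIn
      (openCell_pair_subset hab hyr) (segment_subset_compl (mem_edges.2 ⟨t, ht, hr, h2⟩) hab
        fun h => hri (Or.inr (Or.inl h))) (left_mem_segment ℝ _ _)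
  · have : r = t := Finset.eq_of_subset_of_card_le hr (by rw [M.card_eq_three t ht]; omega)
    exact (hri (Or.inl (this ▸ ht))).elim

lemma exists_vertex_unbounded [Nonempty V] : ∃ v, M.pos v ∉ M.domain ∧
    ¬ Bornology.IsBounded (connectedComponentIn M.domainᶜ (M.pos v)) := by
  obtain ⟨v, hv⟩ := Finite.exists_max (fun v => M.pos v 0)
  have hle : ∀ x ∈ M.domain, x 0 ≤ M.pos v 0 := by
    intro x hx
    obtain ⟨s, -, w, hw, hw1, rfl⟩ := mem_domain.1 hx
    calc (∑ u ∈ s, w u • M.pos u) 0 = ∑ u ∈ s, w u * M.pos u 0 := by simp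
      _ ≤ ∑ u ∈ s, w u * M.pos v 0 :=
        Finset.sum_le_sum fun u hu => mul_le_mul_of_nonneg_left (hv u) (hw u hu).le
      _ = M.pos v 0 := by rw [← Finset.sum_mul, hw1, one_mul]
  let ray : ℝ → EuclideanSpace ℝ (Fin 2) := fun s => M.pos v + s • !₂[1, 0]
  have hray0 : ∀ s, ray s 0 = M.pos v 0 + s := fun s => by simp [ray]
  have hcont : Continuous ray := by fun_prop
  have hsub : ray '' Ici 0 ⊆ M.domainᶜ := by
    rintro _ ⟨s, hs, rfl⟩ hx
    have h1 : ∀ᶠ s' in 𝓝[>] s, ray s' ∈ M.domain :=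
      (hcont.continuousAt.eventually (isOpen_domain.mem_nhds hx)).filter_mono nhdsWithin_le_nhds
    obtain ⟨s', hs', hlt⟩ := (h1.and self_mem_nhdsWithin).exists
    have h2 := hle _ hs'
    rw [hray0] at h2
    have h3 : s < s' := hlt
    have h4 : 0 ≤ s := hs
    linarith
  have hmem : M.pos v ∈ ray '' Ici 0 := ⟨0, by simp, by simp [ray]⟩
  refine ⟨v, hsub hmem, fun hb => ?_⟩
  have h1 := (((convex_Ici (0 : ℝ)).isPreconnected.image ray
    hcont.continuousOn).subset_connectedComponentIn hmem hsub)
  obtain ⟨R, hR⟩ := (hb.subset h1).exists_norm_le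
  have h2 := hR _ ⟨|R| + |M.pos v 0| + 1, by simp only [mem_Ici]; positivity, rfl⟩
  have h3 := (PiLp.norm_apply_le (ray (|R| + |M.pos v 0| + 1)) 0).trans h2
  rw [hray0, Real.norm_eq_abs] at h3
  have h4 := (le_abs_self _).trans h3
  linarith [le_abs_self R, neg_abs_le (M.pos v 0)]

lemma holes_finite : M.holes.Finite := by
  refine (Set.finite_range (fun v => connectedComponentIn M.domainᶜ (M.pos v))).subset ?_
  rintro C ⟨⟨x, hx, rfl⟩, hb⟩
  obtain ⟨v, hv⟩ := exists_vertex_mem hx hb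
  exact ⟨v, (connectedComponentIn_eq hv).symm⟩

lemma hole_eq {C : Set (EuclideanSpace ℝ (Fin 2))} (hC : C ∈ M.holes) (hx : x ∈ C) :
    x ∉ M.domain ∧ C = connectedComponentIn M.domainᶜ x := by
  obtain ⟨⟨y, hy, rfl⟩, -⟩ := hC
  exact ⟨connectedComponentIn_subset _ _ hx, connectedComponentIn_eq hx⟩

/-! ### The basis -/

open Classical in
/-- The indicator functions of the internal vertexes and of the holes. -/
def indicators (M : PlanarMesh V) : M.internalVertices ⊕ M.holes → V → ℝ :=
  Sum.elim (fun v u => if u = v then 1 else 0) (fun C u => if M.pos u ∈ C.1 then 1 else 0)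

lemma indicators_cases (i : M.internalVertices ⊕ M.holes) (u : V) :
    M.indicators i u = 0 ∨ M.indicators i u = 1 := by
  rcases i with v | C <;> simp only [indicators, Sum.elim_inl, Sum.elim_inr] <;> split_ifs <;> simp

lemma borderConst_indicators (i : M.internalVertices ⊕ M.holes) :
    M.BorderConst (M.indicators i) := by
  intro a b hab he hi
  have hseg := segment_subset_compl he hab hi
  rcases i with v | C
  · have h1 : ∀ u ∈ ({a, b} : Finset V), u ≠ v := by
      rintro u hu rfl
      exact hi (edge_internal_of_vertex v.2 he hu)
    simp [indicators, h1 a (by simp), h1 b (by simp)]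
  · have hmem : M.pos a ∈ C.1 ↔ M.pos b ∈ C.1 := by
      constructor <;> intro h
      · rw [(hole_eq C.2 h).2, component_eq he hab hi]
        exact mem_connectedComponentIn (hseg (right_mem_segment ℝ _ _))
      · rw [(hole_eq C.2 h).2, ← component_eq he hab hi]
        exact mem_connectedComponentIn (hseg (left_mem_segment ℝ _ _))
    simp only [indicators, Sum.elim_inr]
    split_ifs <;> tauto

section Combination

variable [Fintype M.holes] (k : M.internalVertices ⊕ M.holes → ℝ)

lemma combination_internal (v : M.internalVertices) :
    ∑ i, k i * M.indicators i v = k (Sum.inl v) := by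
  rw [Finset.sum_eq_single (Sum.inl v)]
  · simp [indicators]
  · rintro (u | C) - h
    · have : (v : V) ≠ u := fun h' => h (by rw [Subtype.ext h'])
      simp [indicators, this]
    · have : M.pos v ∉ C.1 := fun h' => (hole_eq C.2 h').1 (pos_mem_domain.2 v.2)
      simp [indicators, this]
  · simp

lemma combination_hole (C : M.holes) (hv : M.pos v ∈ C.1) :
    ∑ i, k i * M.indicators i v = k (Sum.inr C) := by
  have h0 := hole_eq C.2 hv
  rw [Finset.sum_eq_single (Sum.inr C)]
  · simp [indicators, hv]
  · rintro (u | C') - h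
    · have : v ≠ u := by
        rintro rfl
        exact h0.1 (pos_mem_domain.2 u.2)
      simp [indicators, this]
    · have : M.pos v ∉ C'.1 := fun h' => h (by
        rw [Subtype.ext ((hole_eq C'.2 h').2.trans h0.2.symm)])
      simp [indicators, this]
  · simp

lemma combination_outside (hv : M.pos v ∉ M.domain)
    (hb : ¬ Bornology.IsBounded (connectedComponentIn M.domainᶜ (M.pos v))) :
    ∑ i, k i * M.indicators i v = 0 := by
  refine Finset.sum_eq_zero ?_
  rintro (u | C) -
  · have : v ≠ u := by
      rintro rfl
      exact hv (pos_mem_domain.2 u.2)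
    simp [indicators, this]
  · have : M.pos v ∉ C.1 := fun h' => hb (by rw [← (hole_eq C.2 h').2]; exact C.2.2)
    simp [indicators, this]

end Combination

variable {o : M.EdgeOrientation}

/-- A function on the vertexes with zero differences along all edges is constant. -/
lemma eq_of_grad_eq_zero (hconn : IsConnected M.domain) {g : V → ℝ} (hg : M.BorderConst g)
    (h0 : grad o g = 0) (u v : V) : g u = g v := by
  have hedge : ∀ a b, a ≠ b → {a, b} ∈ M.edges → g a = g b := by
    intro a b hab he
    by_cases hi : {a, b} ∈ M.internalEdges
    · have h1 := congrFun h0 ⟨_, hi⟩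
      simp only [grad, Pi.zero_apply] at h1
      rcases ends_cases o hab hi with ⟨h2, h3⟩ | ⟨h2, h3⟩ <;> rw [h2, h3] at h1 <;> linarith
    · exact hg a b hab he hi
  have helt : ∀ t ∈ M.elements, ∀ a ∈ t, (∑ v ∈ t, g v) / 3 = g a := by
    intro t ht a ha
    have : ∀ b ∈ t, g b = g a := by
      intro b hb
      by_cases hab : b = a
      · rw [hab]
      · refine hedge b a hab (mem_edges.2 ⟨t, ht, ?_, Finset.card_pair hab⟩)
        intro v hv
        simp only [Finset.mem_insert, Finset.mem_singleton] at hv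
        rcases hv with rfl | rfl <;> assumption
    rw [Finset.sum_congr rfl this]
    simp [M.card_eq_three t ht]
  obtain ⟨t, ht, hu⟩ := M.exists_element u
  obtain ⟨t', ht', hv⟩ := M.exists_element v
  rw [← helt t ht u hu, ← helt t' ht' v hv]
  refine eq_of_jump_zero hconn (fun t => (∑ v ∈ t, g v) / 3) ?_ ht ht'
  intro e he r hr r' hr' h h'
  have hne : e.Nonempty := Finset.card_pos.1 (by rw [card_internalEdge he]; norm_num)
  obtain ⟨a, ha⟩ := hne
  rw [helt r hr a (h ha), helt r' hr' a (h' ha)]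

lemma sum_smul_grad {ι : Type*} [Fintype ι] (k : ι → ℝ) (g : ι → V → ℝ) :
    ∑ i, k i • grad o (g i) = grad o (fun u => ∑ i, k i * g i u) := by
  ext e
  simp [grad, mul_sub, Finset.sum_sub_distrib]

lemma borderConst_sum {ι : Type*} [Fintype ι] (k : ι → ℝ) {g : ι → V → ℝ}
    (hg : ∀ i, M.BorderConst (g i)) : M.BorderConst (fun u => ∑ i, k i * g i u) :=
  fun a b hab he hi => Finset.sum_congr rfl fun i _ => by rw [hg i a b hab he hi]

/-- The vectors of the star-patches and of the loops around the holes. -/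
def circuits (o : M.EdgeOrientation) (i : M.internalVertices ⊕ M.holes) :
    LinearMap.ker (M.incidence o).mulVecLin :=
  ⟨grad o (M.indicators i), grad_mem_ker (borderConst_indicators i)⟩

lemma linearIndependent_circuits (hconn : IsConnected M.domain) :
    LinearIndependent ℝ (circuits o) := by
  have := holes_finite (M := M).fintype
  rw [Fintype.linearIndependent_iff]
  intro k hk
  have h1 : grad o (fun u => ∑ i, k i * M.indicators i u) = 0 := by
    rw [← sum_smul_grad]
    simpa [circuits] using congrArg Subtype.val hk
  have hc := eq_of_grad_eq_zero hconn (borderConst_sum k borderConst_indicators) h1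
  have hzero : ∀ u, ∑ i, k i * M.indicators i u = 0 := by
    intro u
    have : Nonempty V := ⟨u⟩
    obtain ⟨v, hv, hb⟩ := exists_vertex_unbounded (M := M)
    exact (hc u v).trans (combination_outside k hv hb)
  rintro (v | C)
  · rw [← combination_internal k, hzero]
  · obtain ⟨⟨x, hx, hC⟩, hb⟩ := C.2
    obtain ⟨v, hv⟩ := exists_vertex_mem hx (hC ▸ hb)
    rw [← combination_hole k C (hC ▸ hv), hzero]

lemma span_circuits : ⊤ ≤ Submodule.span ℝ (Set.range (circuits o)) := by
  have := holes_finite (M := M).fintype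
  rintro ⟨w, hw⟩ -
  obtain ⟨F, hF, hcomp, hout⟩ := exists_potential w hw
  have hvert : ∀ C : M.holes, ∃ v, M.pos v ∈ C.1 := by
    rintro ⟨C, ⟨x, hx, rfl⟩, hb⟩
    exact exists_vertex_mem hx hb
  choose p hp using hvert
  let k : M.internalVertices ⊕ M.holes → ℝ := Sum.elim (fun v => F v) (fun C => F (p C))
  have hk : (fun u => ∑ i, k i * M.indicators i u) = F := by
    funext u
    by_cases hu : M.pos u ∈ M.domain
    · exact combination_internal k ⟨u, pos_mem_domain.1 hu⟩
    · by_cases hb : Bornology.IsBounded (connectedComponentIn M.domainᶜ (M.pos u))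
      · let C : M.holes := ⟨_, ⟨_, hu, rfl⟩, hb⟩
        rw [combination_hole k C (mem_connectedComponentIn hu)]
        exact hcomp (p C) u hu (hp C)
      · rw [combination_outside k hu hb, hout u hu hb]
  have : (⟨w, hw⟩ : LinearMap.ker (M.incidence o).mulVecLin) = ∑ i, k i • circuits o i := by
    apply Subtype.ext
    simp only [AddSubmonoidClass.coe_finsetSum, Submodule.coe_smul, circuits]
    rw [sum_smul_grad, hk, hF]
  rw [this]
  exact Submodule.sum_mem _ fun i _ => Submodule.smul_mem _ _ (Submodule.subset_span ⟨i, rfl⟩)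

end


end PlanarMesh

end

theorem mainTheorem4 {V : Type*} [Fintype V] [DecidableEq V] (M : PlanarMesh V)
    (o : M.EdgeOrientation) (hconn : IsConnected M.domain) :
    (M.incidence o).rank + 1 = M.elements.card ∧
    M.holes.Finite ∧
    Module.finrank ℝ (LinearMap.ker (M.incidence o).mulVecLin) =
      M.internalVertices.card + M.numHoles ∧
    (∃ N : Module.Basis (M.internalVertices ⊕ M.holes) ℝ
        (LinearMap.ker (M.incidence o).mulVecLin),
      (∀ v : M.internalVertices, (N (Sum.inl v) : M.internalEdges → ℝ) = M.rays o v) ∧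
      (∀ C : M.holes, (N (Sum.inr C) : M.internalEdges → ℝ) = M.holeLoop o C) ∧
      (∀ i, M.IsClosedCircuit o (N i : M.internalEdges → ℝ))) ∧
    (M.boundaryEdges.card = M.boundaryVertices.card →
      (M.elements.card : ℤ) - M.edges.card + Fintype.card V = 1 - M.numHoles) := by
  have hrank := PlanarMesh.rank_incidence o hconn
  have hfin : M.holes.Finite := PlanarMesh.holes_finite
  let N := Module.Basis.mk (PlanarMesh.linearIndependent_circuits (o := o) hconn)
    PlanarMesh.span_circuits
  have hN : ∀ i, (N i : M.internalEdges → ℝ) = PlanarMesh.grad o (M.indicators i) := fun i => by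
    rw [Module.Basis.mk_apply]
    rfl
  have hdim : Module.finrank ℝ (LinearMap.ker (M.incidence o).mulVecLin) =
      M.internalVertices.card + M.numHoles := by
    have := hfin.to_subtype
    rw [Module.finrank_eq_nat_card_basis N, Nat.card_sum, Nat.card_coe_set_eq, PlanarMesh.numHoles]
    simp
  refine ⟨hrank, hfin, hdim, ⟨N, fun v => ?_, fun C => ?_, fun i => ?_⟩, fun hE => ?_⟩
  · rw [hN, PlanarMesh.rays_eq_grad]
    rfl
  · rw [hN, PlanarMesh.holeLoop_eq_grad]
    rfl
  · rw [hN]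
    exact PlanarMesh.isClosedCircuit_grad (PlanarMesh.borderConst_indicators i)
      (PlanarMesh.indicators_cases i)
  · have h1 := (M.incidence o).mulVecLin.finrank_range_add_finrank_ker
    rw [hdim] at h1
    have h2 : (M.incidence o).rank + (M.internalVertices.card + M.numHoles) =
        M.internalEdges.card := by
      simpa [Matrix.rank] using h1
    have h3 : M.boundaryEdges.card + M.internalEdges.card = M.edges.card :=
      Finset.card_sdiff_add_card_eq_card (Finset.filter_subset _ _)
    have h4 : M.internalVertices.card + M.boundaryVertices.card = Fintype.card V :=
      Finset.card_sdiff_add_card_eq_card (Finset.subset_univ _)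
    omega
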